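/- Let $\mathbb K$ be $\mathbb R$ or $\mathbb C$; all function spaces consist of $\mathbb K$-valued functions. Let $d\ge 3$, let $q=\frac{2d}{d-2}$, and let $\Omega\subset\mathbb R^d$ be a bounded open set. Let $H^1_0(\Omega)$ be the closure of $C_c^\infty(\Omega)$ in $H^1(\Omega)$, let $\lambda_1(\Omega)$ be the first eigenvalue of the Dirichlet Laplacian on $\Omega$, i.e. the smallest $m\in\mathbb R$ for which there is a nonzero $u\in H^1_0(\Omega)$ with $-\Delta u=mu$ weakly in $\Omega$, and let $0\le\lambda<\lambda_1(\Omega)$. Define, in $[0,\infty]$, $$S_\lambda:=\sup\left\{\int_\Omega|u|^q\ :\ u\in H^1_0(\Omega),\ \|\nabla u\|_{L^2(\Omega)}^2-\lambda\|u\|_{L^2(\Omega)}^2=1\right\},$$ $$S:=\sup\left\{\int_{\mathbb R^d}|u|^q\ :\ u\in H^1(\mathbb R^d),\ \|\nabla u\|_{L^2(\mathbb R^d)}=1\right\}.$$ If $S_\lambda>S$, then $S_\lambda$ is attained: there exists $u\in H^1_0(\Omega)$ with $\|\nabla u\|_{L^2(\Omega)}^2-\lambda\|u\|_{L^2(\Omega)}^2=1$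 and $u\in L^q(\Omega)$ such that $\int_\Omega|u|^q=S_\lambda$. -/

import Mathlib

open MeasureTheory TopologicalSpace
open scoped ENNReal Distributions

/-- The Hilbert space `L²(Ω; 𝕜) × L²(Ω; 𝕜ᵈ)` of pairs (function, candidate gradient), with its
Hilbertian product norm. -/
abbrev L2Pair (𝕜 : Type*) [RCLike 𝕜] {d : ℕ} (Ω : Opens (EuclideanSpace ℝ (Fin d))) : Type _ :=
  WithLp 2
    (Lp 𝕜 2 ((volume : Measure (EuclideanSpace ℝ (Fin d))).restrict Ω) ×
      Lp (EuclideanSpace 𝕜 (Fin d)) 2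
        ((volume : Measure (EuclideanSpace ℝ (Fin d))).restrict Ω))

/-- `G` is the weak (distributional) gradient of `u` on `Ω`: for every smooth `ψ` with compact
support in `Ω` and every `i`, `∫_Ω (∂ᵢψ) u = - ∫_Ω ψ Gᵢ`. -/
def IsWeakGradient {𝕜 : Type*} [RCLike 𝕜] {d : ℕ} (Ω : Opens (EuclideanSpace ℝ (Fin d)))
    (u : EuclideanSpace ℝ (Fin d) → 𝕜)
    (G : EuclideanSpace ℝ (Fin d) → EuclideanSpace 𝕜 (Fin d)) : Prop :=
  ∀ (ψ : 𝓓(Ω, ℝ)) (i : Fin d),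
    ∫ x in (Ω : Set (EuclideanSpace ℝ (Fin d))),
        (fderiv ℝ ψ x (EuclideanSpace.single i 1)) • u x
      = - ∫ x in (Ω : Set (EuclideanSpace ℝ (Fin d))), ψ x • G x i

/-- The test function multiplied by a square-integrable function is integrable. -/
theorem integrable_test_smul {F : Type*} [NormedAddCommGroup F] [NormedSpace ℝ F] {d : ℕ}
    {μ : Measure (EuclideanSpace ℝ (Fin d))} [IsLocallyFiniteMeasure μ]
    {φ : EuclideanSpace ℝ (Fin d) → ℝ} (hφ : Continuous φ) (hc : HasCompactSupport φ)
    {f : EuclideanSpace ℝ (Fin d) → F} (hf : MemLp f 2 μ) :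
    Integrable (fun x => φ x • f x) μ :=
  (hf.locallyIntegrable (by norm_num)).integrable_smul_left_of_hasCompactSupport hφ hc

/-- The Sobolev space `H¹(Ω)` of all `u ∈ L²(Ω)` with a weak gradient in `L²(Ω)`, realised as the
space of pairs `U = (u, ∇u)`; thus `U.fst = u`, `U.snd = ∇u` and
`‖U‖² = ‖u‖²_{L²} + ‖∇u‖²_{L²}`. The weak gradient is unique, so `U` is determined by `u`. -/
def H1 (𝕜 : Type*) [RCLike 𝕜] {d : ℕ} (Ω : Opens (EuclideanSpace ℝ (Fin d))) :
    Submodule 𝕜 (L2Pair 𝕜 Ω) where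
  carrier := {U | IsWeakGradient Ω U.fst U.snd}
  zero_mem' := by
    intro ψ i
    have h1 := Lp.coeFn_zero 𝕜 2 ((volume : Measure (EuclideanSpace ℝ (Fin d))).restrict Ω)
    have h2 := Lp.coeFn_zero (EuclideanSpace 𝕜 (Fin d)) 2
      ((volume : Measure (EuclideanSpace ℝ (Fin d))).restrict Ω)
    rw [integral_eq_zero_of_ae, integral_eq_zero_of_ae, neg_zero]
    · filter_upwards [h2] with x hx
      rw [WithLp.zero_snd, hx]
      simp
    · filter_upwards [h1] with x hx
      rw [WithLp.zero_fst, hx]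
      simp
  add_mem' := by
    intro U V hU hV ψ i
    have hd : Continuous fun x => fderiv ℝ ψ x (EuclideanSpace.single i 1) :=
      (ψ.contDiff.continuous_fderiv (by simp)).clm_apply continuous_const
    have hdc : HasCompactSupport fun x => fderiv ℝ ψ x (EuclideanSpace.single i 1) :=
      ψ.hasCompactSupport.fderiv_apply (𝕜 := ℝ) _
    have e1 : ∫ x in (Ω : Set (EuclideanSpace ℝ (Fin d))),
          (fderiv ℝ ψ x (EuclideanSpace.single i 1)) • (U + V).fst x
        = ∫ x in (Ω : Set (EuclideanSpace ℝ (Fin d))),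
          ((fderiv ℝ ψ x (EuclideanSpace.single i 1)) • U.fst x
            + (fderiv ℝ ψ x (EuclideanSpace.single i 1)) • V.fst x) := by
      refine integral_congr_ae ?_
      filter_upwards [Lp.coeFn_add U.fst V.fst] with x hx
      rw [WithLp.add_fst, hx, Pi.add_apply, smul_add]
    have e2 : ∫ x in (Ω : Set (EuclideanSpace ℝ (Fin d))), ψ x • (U + V).snd x i
        = ∫ x in (Ω : Set (EuclideanSpace ℝ (Fin d))),
          (ψ x • U.snd x i + ψ x • V.snd x i) := by
      refine integral_congr_ae ?_
      filter_upwards [Lp.coeFn_add U.snd V.snd] with x hx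
      rw [WithLp.add_snd, hx, Pi.add_apply, PiLp.add_apply, smul_add]
    rw [e1, e2, integral_add (integrable_test_smul hd hdc (Lp.memLp U.fst))
      (integrable_test_smul hd hdc (Lp.memLp V.fst)),
      integral_add
        (integrable_test_smul ψ.continuous ψ.hasCompactSupport ((Lp.memLp U.snd).eval_piLp i))
        (integrable_test_smul ψ.continuous ψ.hasCompactSupport ((Lp.memLp V.snd).eval_piLp i)),
      hU ψ i, hV ψ i, neg_add]
  smul_mem' := by
    intro c U hU ψ i
    have e1 : ∫ x in (Ω : Set (EuclideanSpace ℝ (Fin d))),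
          (fderiv ℝ ψ x (EuclideanSpace.single i 1)) • (c • U).fst x
        = ∫ x in (Ω : Set (EuclideanSpace ℝ (Fin d))),
          c • ((fderiv ℝ ψ x (EuclideanSpace.single i 1)) • U.fst x) := by
      refine integral_congr_ae ?_
      filter_upwards [Lp.coeFn_smul c U.fst] with x hx
      simp only [WithLp.smul_fst, hx, Pi.smul_apply]
      rw [smul_comm]
    have e2 : ∫ x in (Ω : Set (EuclideanSpace ℝ (Fin d))), ψ x • (c • U).snd x i
        = ∫ x in (Ω : Set (EuclideanSpace ℝ (Fin d))), c • (ψ x • U.snd x i) := by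
      refine integral_congr_ae ?_
      filter_upwards [Lp.coeFn_smul c U.snd] with x hx
      simp only [WithLp.smul_snd, hx, Pi.smul_apply, PiLp.smul_apply]
      rw [smul_comm]
    rw [e1, e2, integral_smul, integral_smul, hU ψ i, smul_neg]

/-- The elements of `H¹(Ω)` that are represented by a function of `C_c^∞(Ω)`. -/
def testH1 (𝕜 : Type*) [RCLike 𝕜] {d : ℕ} (Ω : Opens (EuclideanSpace ℝ (Fin d))) :
    Submodule 𝕜 (H1 𝕜 Ω) where
  carrier := {U | ∃ φ : 𝓓(Ω, 𝕜),
    (U : L2Pair 𝕜 Ω).fst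
      =ᵐ[(volume : Measure (EuclideanSpace ℝ (Fin d))).restrict Ω] φ}
  zero_mem' := ⟨0, by
    filter_upwards [Lp.coeFn_zero 𝕜 2
      ((volume : Measure (EuclideanSpace ℝ (Fin d))).restrict Ω)] with x hx
    simpa using hx⟩
  add_mem' := by
    rintro U V ⟨φ, hφ⟩ ⟨χ, hχ⟩
    refine ⟨φ + χ, ?_⟩
    filter_upwards [hφ, hχ, Lp.coeFn_add (U : L2Pair 𝕜 Ω).fst (V : L2Pair 𝕜 Ω).fst]
      with x h1 h2 h3
    rw [Submodule.coe_add, WithLp.add_fst, h3, Pi.add_apply, h1, h2]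
    rfl
  smul_mem' := by
    rintro c U ⟨φ, hφ⟩
    refine ⟨c • φ, ?_⟩
    filter_upwards [hφ, Lp.coeFn_smul c (U : L2Pair 𝕜 Ω).fst] with x h1 h2
    simp [h1, h2]

/-- `H¹₀(Ω)`, the closure of `C_c^∞(Ω)` in `H¹(Ω)`. -/
noncomputable def H10 (𝕜 : Type*) [RCLike 𝕜] {d : ℕ} (Ω : Opens (EuclideanSpace ℝ (Fin d))) :
    Submodule 𝕜 (H1 𝕜 Ω) :=
  (testH1 𝕜 Ω).topologicalClosure

/-- The function `u ∈ L²(Ω)` underlying an element of `H¹(Ω)`. -/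
noncomputable def fnPart {𝕜 : Type*} [RCLike 𝕜] {d : ℕ} {Ω : Opens (EuclideanSpace ℝ (Fin d))}
    (u : H1 𝕜 Ω) : Lp 𝕜 2 ((volume : Measure (EuclideanSpace ℝ (Fin d))).restrict Ω) :=
  (u : L2Pair 𝕜 Ω).fst

/-- The weak gradient `∇u ∈ L²(Ω; 𝕜ᵈ)` of an element of `H¹(Ω)`. -/
noncomputable def gradPart {𝕜 : Type*} [RCLike 𝕜] {d : ℕ} {Ω : Opens (EuclideanSpace ℝ (Fin d))}
    (u : H1 𝕜 Ω) :
    Lp (EuclideanSpace 𝕜 (Fin d)) 2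
      ((volume : Measure (EuclideanSpace ℝ (Fin d))).restrict Ω) :=
  (u : L2Pair 𝕜 Ω).snd

/-- `m` is an eigenvalue of the Dirichlet Laplacian on `Ω`: the problem `-Δu = m u` has a nonzero
weak solution `u ∈ H¹₀(Ω)`. -/
def IsDirichletEigenvalue (𝕜 : Type*) [RCLike 𝕜] {d : ℕ}
    (Ω : Opens (EuclideanSpace ℝ (Fin d))) (m : ℝ) : Prop :=
  ∃ u ∈ H10 𝕜 Ω, u ≠ 0 ∧
    ∀ v ∈ H10 𝕜 Ω, inner 𝕜 (gradPart v) (gradPart u) = (m : 𝕜) * inner 𝕜 (fnPart v) (fnPart u)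

/-- `λ₁(Ω)`, the first eigenvalue of the Dirichlet Laplacian on `Ω`. -/
noncomputable def lambda1 (𝕜 : Type*) [RCLike 𝕜] {d : ℕ}
    (Ω : Opens (EuclideanSpace ℝ (Fin d))) : ℝ :=
  sInf {m : ℝ | IsDirichletEigenvalue 𝕜 Ω m}

/-- The critical Sobolev exponent `q = 2d/(d-2)`. -/
noncomputable def critExp (d : ℕ) : ℝ := 2 * (d : ℝ) / ((d : ℝ) - 2)

/-- `∫_Ω |u|^q` with the critical exponent `q`, as an element of `[0, ∞]`. -/
noncomputable def critIntegral {𝕜 : Type*} [RCLike 𝕜] {d : ℕ}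
    {Ω : Opens (EuclideanSpace ℝ (Fin d))} (u : H1 𝕜 Ω) : ℝ≥0∞ :=
  ∫⁻ x in (Ω : Set (EuclideanSpace ℝ (Fin d))), ‖fnPart u x‖ₑ ^ critExp d

/-- The Brézis–Nirenberg constant
`S_λ = sup {∫_Ω |u|^q : u ∈ H¹₀(Ω), ‖∇u‖² - λ ‖u‖² = 1}`, as an element of `[0, ∞]`. -/
noncomputable def brezisNirenbergConst (𝕜 : Type*) [RCLike 𝕜] {d : ℕ}
    (Ω : Opens (EuclideanSpace ℝ (Fin d))) (lam : ℝ) : ℝ≥0∞ :=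
  ⨆ u ∈ {u : H1 𝕜 Ω | u ∈ H10 𝕜 Ω ∧ ‖gradPart u‖ ^ 2 - lam * ‖fnPart u‖ ^ 2 = 1}, critIntegral u

/-- The Sobolev constant `S = sup {∫_{ℝᵈ} |u|^q : u ∈ H¹(ℝᵈ), ‖∇u‖ = 1}`, as an element of
`[0, ∞]`. -/
noncomputable def sobolevConst (𝕜 : Type*) [RCLike 𝕜] (d : ℕ) : ℝ≥0∞ :=
  ⨆ u ∈ {u : H1 𝕜 (⊤ : Opens (EuclideanSpace ℝ (Fin d))) | ‖gradPart u‖ = 1}, critIntegral u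

/-! Take a maximising sequence `v n` for `S_λ`. Since `λ < λ₁`, the form `Q(u) = ‖∇u‖² - λ‖u‖²` is
coercive on `H¹₀(Ω)` (`exists_norm_sq_le_mul_form`), so the sequence is bounded. A subsequence
converges to some `u` strongly in `L²`, almost everywhere, and weakly at the level of gradients. Put
`t = Q(u)`. The lower-order term passes to the limit, so `‖∇(v n - u)‖² → 1 - t`
(`tendsto_norm_gradPart_sub_sq`), and in particular `0 ≤ t ≤ 1`.

The Brezis–Lieb lemma splits the critical integral into that of `u` and that of the remainder `v n -
u`. The remainder sees only the gradient, so it obeys the Sobolev inequality with the constant `S`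
of the whole space (`le_critIntegral_add_of_tendsto`). Hence `S_λ ≤ S_λ t^(q/2) + S (1-t)^(q/2) ≤
S_λ t + S (1-t)`. As `S < S_λ < ∞`, this forces `t = 1`: no mass is lost to concentration, and the
first inequality becomes `S_λ ≤ ∫|u|^q`.

Two classical facts carry this. Rellich's theorem (`tendsto_fnPartL_of_weak_tendsto_zero`) is proved
by comparing functions with their ball averages. The Rayleigh bound for `λ₁`
(`lambda1_mul_norm_sq_le`) holds because the compact embedding `H¹₀ → L²` attains its norm at an
eigenfunction. Finiteness of `S` needs no proof, as it follows from `S < S_λ`. -/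

/-! ### Weak compactness and attained operator norms in Hilbert space -/

open Filter Topology in
/-- Bounded sequences in a separable Hilbert space have weakly convergent subsequences. -/
theorem exists_subseq_weak_tendsto {𝕜 H : Type*} [RCLike 𝕜] [NormedAddCommGroup H]
    [InnerProductSpace 𝕜 H] [CompleteSpace H] [SeparableSpace H] (u : ℕ → H) (R : ℝ)
    (hu : ∀ n, ‖u n‖ ≤ R) :
    ∃ (u₀ : H) (φ : ℕ → ℕ), StrictMono φ ∧
      ∀ v : H, Tendsto (fun n => inner 𝕜 v (u (φ n))) atTop (𝓝 (inner 𝕜 v u₀)) := by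
  -- The Riesz isometry moves the sequence into a ball of the dual, which is weak-* sequentially
  -- compact by separability. The conjugations below only exchange the two slots of the inner
  -- product.
  have hc := WeakDual.isSeqCompact_closedBall 𝕜 H (0 : StrongDual 𝕜 H) R
  obtain ⟨ℓ, -, φ, hφ, hlim⟩ := hc
    (x := fun n => StrongDual.toWeakDual (InnerProductSpace.toDual 𝕜 H (u n))) (fun n => by
      simpa using hu n)
  refine ⟨(InnerProductSpace.toDual 𝕜 H).symm (WeakDual.toStrongDual ℓ), φ, hφ, fun v => ?_⟩
  have h1 := ((WeakDual.eval_continuous v).tendsto ℓ).comp hlim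
  have h2 := ((RCLike.continuous_conj (K := 𝕜)).tendsto _).comp h1
  have e : (starRingEnd 𝕜) (ℓ v)
      = inner 𝕜 v ((InnerProductSpace.toDual 𝕜 H).symm (WeakDual.toStrongDual ℓ)) := by
    rw [← inner_conj_symm, InnerProductSpace.toDual_symm_apply]
    rfl
  rw [e] at h2
  refine h2.congr fun n => ?_
  rw [← inner_conj_symm]
  rfl

open Filter Topology in
/-- If `J` maps bounded weakly null sequences to null sequences, then a nonzero `J` attains its
operator norm at a unit vector, which is an eigenvector of `J†J`. -/
theorem exists_inner_map_eq_norm_sq {𝕜 H F : Type*} [RCLike 𝕜] [NormedAddCommGroup H]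
    [InnerProductSpace 𝕜 H] [CompleteSpace H] [SeparableSpace H]
    [NormedAddCommGroup F] [InnerProductSpace 𝕜 F] [CompleteSpace F] (J : H →L[𝕜] F) (hJ : J ≠ 0)
    (hcomp : ∀ (u : ℕ → H) (R : ℝ), (∀ n, ‖u n‖ ≤ R) →
      (∀ v, Tendsto (fun n => inner 𝕜 v (u n)) atTop (𝓝 0)) →
      Tendsto (fun n => J (u n)) atTop (𝓝 0)) :
    ∃ x : H, x ≠ 0 ∧ ∀ v, inner 𝕜 (J v) (J x) = ((‖J‖ ^ 2 : ℝ) : 𝕜) * inner 𝕜 v x := by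
  have hJpos : 0 < ‖J‖ := norm_pos_iff.2 hJ
  have hex : ∀ n : ℕ, ∃ x : H, ‖x‖ ≤ 1 ∧ ‖J‖ - 1 / ((n : ℝ) + 1) < ‖J x‖ := by
    intro n
    obtain ⟨x, hx, hx'⟩ := J.exists_lt_apply_of_lt_opNorm
      (r := ‖J‖ - 1 / ((n : ℝ) + 1)) (by
        have : (0 : ℝ) < 1 / ((n : ℝ) + 1) := by positivity
        linarith)
    exact ⟨x, hx.le, hx'⟩
  choose u hu hu' using hex
  obtain ⟨x, φ, hφ, hw⟩ := exists_subseq_weak_tendsto (𝕜 := 𝕜) u 1 hu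
  have hJu : Tendsto (fun n => J (u (φ n))) atTop (𝓝 (J x)) := by
    have := hcomp (fun n => u (φ n) - x) (1 + ‖x‖)
      (fun n => (norm_sub_le _ _).trans (by gcongr; exact hu _)) (fun v => by
        have := (hw v).sub_const (inner 𝕜 v x)
        simpa [inner_sub_right] using this)
    have h2 := this.add_const (J x)
    simpa using h2
  have hnorm : ‖J‖ ≤ ‖J x‖ := by
    have h1 : Tendsto (fun n => ‖J‖ - 1 / (((φ n : ℕ) : ℝ) + 1)) atTop (𝓝 (‖J‖ - 0)) :=
      tendsto_const_nhds.sub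
        ((tendsto_one_div_add_atTop_nhds_zero_nat (𝕜 := ℝ)).comp hφ.tendsto_atTop)
    rw [sub_zero] at h1
    exact le_of_tendsto_of_tendsto' h1 hJu.norm fun n => (hu' _).le
  -- Weak lower semicontinuity of the norm: `‖x‖² = lim |⟨x, u (φ n)⟩| ≤ ‖x‖`.
  have hx1 : ‖x‖ ≤ 1 := by
    by_cases hx0 : x = 0
    · simp [hx0]
    have h1 := (hw x).norm
    have h2 : ‖inner 𝕜 x x‖ ≤ ‖x‖ * 1 :=
      le_of_tendsto' h1 fun n => (norm_inner_le_norm _ _).trans (by gcongr; exact hu _)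
    rw [inner_self_eq_norm_sq_to_K] at h2
    simp only [norm_pow, RCLike.norm_ofReal, abs_norm] at h2
    have : 0 < ‖x‖ := norm_pos_iff.2 hx0
    nlinarith
  have hx0 : x ≠ 0 := by
    rintro rfl
    simp at hnorm
    exact hJ hnorm
  refine ⟨x, hx0, fun v => ?_⟩
  set y : H := J.adjoint (J x) with hy
  have hyn : ‖y‖ ≤ ‖J‖ ^ 2 := by
    calc ‖y‖ ≤ ‖J.adjoint‖ * ‖J x‖ := J.adjoint.le_opNorm _
      _ ≤ ‖J‖ * (‖J‖ * 1) := by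
          rw [LinearIsometryEquiv.norm_map]
          gcongr
          exact (J.le_opNorm _).trans (by gcongr)
      _ = ‖J‖ ^ 2 := by ring
  -- Equality case of Cauchy–Schwarz: since `⟨y, x⟩ = ‖J x‖² ≥ ‖J‖²`, expanding the square gives at
  -- most `‖J‖⁴ - 2‖J‖⁴ + ‖J‖⁴ = 0`.
  have hyx : y = ((‖J‖ ^ 2 : ℝ) : 𝕜) • x := by
    rw [← sub_eq_zero, ← norm_eq_zero, ← sq_eq_zero_iff]
    refine le_antisymm ?_ (sq_nonneg _)
    rw [norm_sub_sq (𝕜 := 𝕜), inner_smul_right, RCLike.re_ofReal_mul, norm_smul,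
      RCLike.norm_ofReal, abs_of_nonneg (by positivity), hy, ContinuousLinearMap.adjoint_inner_left,
      inner_self_eq_norm_sq, ← hy]
    have h1 : ‖y‖ ^ 2 ≤ (‖J‖ ^ 2) ^ 2 := by gcongr
    have h2 : ‖J‖ ^ 2 ≤ ‖J x‖ ^ 2 := by gcongr
    have h3 : (‖J‖ ^ 2 * ‖x‖) ^ 2 ≤ (‖J‖ ^ 2 * 1) ^ 2 := by gcongr
    have h4 : ‖J‖ ^ 2 * ‖J‖ ^ 2 ≤ ‖J‖ ^ 2 * ‖J x‖ ^ 2 := by gcongr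
    nlinarith
  rw [← ContinuousLinearMap.adjoint_inner_right, ← hy, hyx, inner_smul_right]

/-! ### The Brezis–Lieb lemma -/

open NNReal in
/-- `(x + y) ^ p ≤ c x ^ p + C y ^ p` for every `c > 1`, with `C` depending on `c` and `p`. -/
theorem ENNReal.exists_add_rpow_le {p : ℝ} (hp : 1 < p) {c : ℝ≥0} (hc : 1 < c) :
    ∃ C : ℝ≥0, ∀ x y : ℝ≥0∞, (x + y) ^ p ≤ c * x ^ p + C * y ^ p := by
  have hp1 : 0 < p - 1 := by linarith
  -- Convexity applied to `x + y = w (x/w) + v (y/v)` with `w + v = 1` yields the coefficients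
  -- `w^(1-p)` and `v^(1-p)`; this `w` solves `w^(1-p) = c`.
  set w : ℝ≥0 := c ^ (-(1 / (p - 1))) with hw
  have hc0 : c ≠ 0 := (zero_lt_one.trans hc).ne'
  have hw0 : w ≠ 0 := (NNReal.rpow_pos (zero_lt_one.trans hc)).ne'
  have hw1 : w < 1 := NNReal.rpow_lt_one_of_one_lt_of_neg hc (by
    have : 0 < 1 / (p - 1) := by positivity
    linarith)
  set v : ℝ≥0 := 1 - w with hv
  have hv0 : v ≠ 0 := (tsub_pos_of_lt hw1).ne'
  have hwv : w + v = 1 := add_tsub_cancel_of_le hw1.le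
  refine ⟨v * v⁻¹ ^ p, fun x y => ?_⟩
  have h := ENNReal.rpow_arith_mean_le_arith_mean2_rpow (w : ℝ≥0∞) (v : ℝ≥0∞)
    ((w⁻¹ : ℝ≥0) * x) ((v⁻¹ : ℝ≥0) * y) (by exact_mod_cast hwv) hp.le
  have hcw : w * w⁻¹ ^ p = c := by
    have e1 : w⁻¹ = c ^ (1 / (p - 1)) := by rw [hw, NNReal.rpow_neg, inv_inv]
    rw [e1, hw, ← NNReal.rpow_mul, ← NNReal.rpow_add hc0]
    have : -(1 / (p - 1)) + 1 / (p - 1) * p = 1 := by field_simp; ring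
    rw [this, NNReal.rpow_one]
  have a1 : (w : ℝ≥0∞) * ((w⁻¹ : ℝ≥0) * x) = x := by
    rw [← mul_assoc, ← ENNReal.coe_mul, mul_inv_cancel₀ hw0, ENNReal.coe_one, one_mul]
  have a2 : (v : ℝ≥0∞) * ((v⁻¹ : ℝ≥0) * y) = y := by
    rw [← mul_assoc, ← ENNReal.coe_mul, mul_inv_cancel₀ hv0, ENNReal.coe_one, one_mul]
  rw [a1, a2, ENNReal.mul_rpow_of_nonneg _ _ (by linarith),
    ENNReal.mul_rpow_of_nonneg _ _ (by linarith), ← mul_assoc, ← mul_assoc,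
    ← ENNReal.coe_rpow_of_nonneg _ (by linarith), ← ENNReal.coe_rpow_of_nonneg _ (by linarith),
    ← ENNReal.coe_mul, ← ENNReal.coe_mul, hcw] at h
  exact h

open Filter Topology NNReal in
/-- The one-sided **Brezis–Lieb lemma**. -/
theorem tendsto_lintegral_enorm_rpow_sub {α E : Type*} [MeasurableSpace α] {μ : Measure α}
    [NormedAddCommGroup E] {p : ℝ} (hp : 1 < p) {c : ℝ≥0} (hc : 1 < c) {f : ℕ → α → E} {g : α → E}
    (hf : ∀ n, AEStronglyMeasurable (f n) μ) (hg : AEStronglyMeasurable g μ)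
    (hlim : ∀ᵐ x ∂μ, Tendsto (fun n => f n x) atTop (𝓝 (g x)))
    (hfin : ∫⁻ x, ‖g x‖ₑ ^ p ∂μ ≠ ⊤) :
    Tendsto (fun n => ∫⁻ x, (‖f n x‖ₑ ^ p - c * ‖f n x - g x‖ₑ ^ p) ∂μ) atTop
      (𝓝 (∫⁻ x, ‖g x‖ₑ ^ p ∂μ)) := by
  obtain ⟨C, hC⟩ := ENNReal.exists_add_rpow_le hp hc
  have hp0 : 0 < p := by linarith
  -- Writing `f n = (f n - g) + g`, the preceding inequality bounds the truncated difference by `C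
  -- |g|^p`. Truncation at zero supplies the lower bound, so no bound on `f n` is needed.
  refine tendsto_lintegral_of_dominated_convergence' (fun x => C * ‖g x‖ₑ ^ p) (fun n => ?_)
    (fun n => ?_) ?_ ?_
  · exact ((hf n).enorm.pow_const p).sub ((((hf n).sub hg).enorm.pow_const p).const_mul _)
  · refine Eventually.of_forall fun x => ?_
    rw [tsub_le_iff_left]
    refine le_trans ?_ (hC _ _)
    gcongr
    simpa using enorm_add_le (f n x - g x) (g x)
  · rw [lintegral_const_mul'' _ (hg.enorm.pow_const p)]
    exact ENNReal.mul_ne_top ENNReal.coe_ne_top hfin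
  · filter_upwards [hlim] with x hx
    have h1 : Tendsto (fun n => ‖f n x‖ₑ ^ p) atTop (𝓝 (‖g x‖ₑ ^ p)) :=
      (ENNReal.continuous_rpow_const.tendsto _).comp ((continuous_enorm.tendsto _).comp hx)
    have h2 : Tendsto (fun n => (c : ℝ≥0∞) * ‖f n x - g x‖ₑ ^ p) atTop (𝓝 (c * 0)) := by
      refine ENNReal.Tendsto.const_mul ?_ (Or.inr ENNReal.coe_ne_top)
      have h3 : Tendsto (fun n => f n x - g x) atTop (𝓝 0) := by
        simpa using hx.sub_const (g x)
      have h4 := (ENNReal.continuous_rpow_const (y := p)).tendsto ‖(0 : E)‖ₑ |>.comp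
        ((continuous_enorm.tendsto _).comp h3)
      rw [enorm_zero, ENNReal.zero_rpow_of_pos hp0] at h4
      exact h4
    have h5 := ENNReal.Tendsto.sub h1 h2 (Or.inr (by simp))
    simpa using h5

/-! ### Closedness and completeness of the Sobolev spaces -/

/-- The integral is the `L²` inner product with `g`, which is real, so conjugation disappears. Such
continuity lets weak-gradient identities pass to `L²` limits. -/
theorem continuous_integral_smul_Lp {𝕜 : Type*} [RCLike 𝕜] {d : ℕ}
    {μ : Measure (EuclideanSpace ℝ (Fin d))} [IsLocallyFiniteMeasure μ]
    {g : EuclideanSpace ℝ (Fin d) → ℝ} (hg : Continuous g) (hc : HasCompactSupport g) :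
    Continuous fun u : Lp 𝕜 2 μ => ∫ x, g x • u x ∂μ := by
  have hG : MemLp (fun x => (g x : 𝕜)) 2 μ :=
    (RCLike.continuous_ofReal.comp hg).memLp_of_hasCompactSupport
      (hc.comp_left (g := fun r : ℝ => (r : 𝕜)) (by simp))
  have : (fun u : Lp 𝕜 2 μ => ∫ x, g x • u x ∂μ) = fun u => inner 𝕜 (hG.toLp _) u := by
    funext u
    rw [L2.inner_def]
    refine integral_congr_ae ?_
    filter_upwards [hG.coeFn_toLp] with x hx
    rw [hx, RCLike.inner_apply, RCLike.conj_ofReal, RCLike.real_smul_eq_coe_mul, mul_comm]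
  rw [this]
  fun_prop

theorem continuous_integral_smul_Lp_apply {𝕜 : Type*} [RCLike 𝕜] {d : ℕ}
    {μ : Measure (EuclideanSpace ℝ (Fin d))} [IsLocallyFiniteMeasure μ]
    {g : EuclideanSpace ℝ (Fin d) → ℝ} (hg : Continuous g) (hc : HasCompactSupport g) (i : Fin d) :
    Continuous fun G : Lp (EuclideanSpace 𝕜 (Fin d)) 2 μ => ∫ x, g x • G x i ∂μ := by
  have hG : MemLp (fun x => EuclideanSpace.single i (g x : 𝕜)) 2 μ := by
    refine Continuous.memLp_of_hasCompactSupport ?_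
      (hc.comp_left (g := fun r : ℝ => EuclideanSpace.single i (r : 𝕜)) (by simp))
    have : Isometry fun a : 𝕜 => EuclideanSpace.single (𝕜 := 𝕜) i a :=
      Isometry.of_dist_eq fun a b => by simp
    exact this.continuous.comp (RCLike.continuous_ofReal.comp hg)
  have : (fun G : Lp (EuclideanSpace 𝕜 (Fin d)) 2 μ => ∫ x, g x • G x i ∂μ)
      = fun G => inner 𝕜 (hG.toLp _) G := by
    funext G
    rw [L2.inner_def]
    refine integral_congr_ae ?_
    filter_upwards [hG.coeFn_toLp] with x hx
    rw [hx, EuclideanSpace.inner_single_left, RCLike.conj_ofReal, RCLike.real_smul_eq_coe_mul]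
  rw [this]
  fun_prop

section Sobolev

variable {𝕜 : Type*} [RCLike 𝕜] {d : ℕ} {Ω : Opens (EuclideanSpace ℝ (Fin d))}

theorem continuous_L2Pair_fst : Continuous fun U : L2Pair 𝕜 Ω => U.fst :=
  WithLp.continuous_fst 2 _ _

theorem continuous_L2Pair_snd : Continuous fun U : L2Pair 𝕜 Ω => U.snd :=
  WithLp.continuous_snd 2 _ _

/-- The set of pairs satisfying the weak gradient identity against a fixed test function on the
whole space is closed. -/
theorem isClosed_setOf_weakGradient_identity {g : EuclideanSpace ℝ (Fin d) → ℝ}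
    (hg : ContDiff ℝ 1 g) (hc : HasCompactSupport g) (i : Fin d) :
    IsClosed {U : L2Pair 𝕜 Ω | ∫ x in (Ω : Set (EuclideanSpace ℝ (Fin d))),
        (fderiv ℝ g x (EuclideanSpace.single i 1)) • U.fst x
      = - ∫ x in (Ω : Set (EuclideanSpace ℝ (Fin d))), g x • U.snd x i} := by
  have hd : Continuous fun x => fderiv ℝ g x (EuclideanSpace.single i 1) :=
    (hg.continuous_fderiv (by simp)).clm_apply continuous_const
  have hdc : HasCompactSupport fun x => fderiv ℝ g x (EuclideanSpace.single i 1) :=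
    hc.fderiv_apply (𝕜 := ℝ) _
  refine isClosed_eq ((continuous_integral_smul_Lp hd hdc).comp continuous_L2Pair_fst) ?_
  exact ((continuous_integral_smul_Lp_apply hg.continuous hc i).comp continuous_L2Pair_snd).neg

theorem isClosed_H1 : IsClosed (H1 𝕜 Ω : Set (L2Pair 𝕜 Ω)) := by
  have : (H1 𝕜 Ω : Set (L2Pair 𝕜 Ω)) = ⋂ (ψ : 𝓓(Ω, ℝ)) (i : Fin d),
      {U : L2Pair 𝕜 Ω | ∫ x in (Ω : Set (EuclideanSpace ℝ (Fin d))),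
        (fderiv ℝ ψ x (EuclideanSpace.single i 1)) • U.fst x
      = - ∫ x in (Ω : Set (EuclideanSpace ℝ (Fin d))), ψ x • U.snd x i} := by
    ext U
    simp only [Set.mem_iInter]
    rfl
  rw [this]
  exact isClosed_iInter fun ψ => isClosed_iInter fun i =>
    isClosed_setOf_weakGradient_identity (ψ.contDiff.of_le (by simp)) ψ.hasCompactSupport i

instance : CompleteSpace (H1 𝕜 Ω) := isClosed_H1.completeSpace_coe

instance : CompleteSpace (H10 𝕜 Ω) :=
  (Submodule.isClosed_topologicalClosure (testH1 𝕜 Ω)).completeSpace_coe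

instance : SecondCountableTopology (L2Pair 𝕜 Ω) := by
  have : Fact ((2 : ℝ≥0∞) ≠ ⊤) := ⟨by simp⟩
  have : SecondCountableTopology
      (Lp 𝕜 2 ((volume : Measure (EuclideanSpace ℝ (Fin d))).restrict Ω)) :=
    Lp.SecondCountableTopology
  have : SecondCountableTopology
      (Lp (EuclideanSpace 𝕜 (Fin d)) 2
        ((volume : Measure (EuclideanSpace ℝ (Fin d))).restrict Ω)) :=
    Lp.SecondCountableTopology
  exact WithLp.secondCountableTopology 2 _ _

instance : SeparableSpace (H10 𝕜 Ω) := inferInstance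

theorem norm_sq_H1 (U : H1 𝕜 Ω) : ‖U‖ ^ 2 = ‖fnPart U‖ ^ 2 + ‖gradPart U‖ ^ 2 := by
  exact WithLp.prod_norm_sq_eq_of_L2 (U : L2Pair 𝕜 Ω)

theorem norm_fnPart_le (U : H1 𝕜 Ω) : ‖fnPart U‖ ≤ ‖U‖ := by
  refine le_of_sq_le_sq ?_ (norm_nonneg _)
  rw [norm_sq_H1]
  nlinarith [sq_nonneg ‖gradPart U‖]

theorem norm_gradPart_le (U : H1 𝕜 Ω) : ‖gradPart U‖ ≤ ‖U‖ := by
  refine le_of_sq_le_sq ?_ (norm_nonneg _)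
  rw [norm_sq_H1]
  nlinarith [sq_nonneg ‖fnPart U‖]

variable (𝕜 Ω) in
/-- The inclusion `H¹₀(Ω) → L²(Ω)`. -/
noncomputable def fnPartL :
    H10 𝕜 Ω →L[𝕜] Lp 𝕜 2 ((volume : Measure (EuclideanSpace ℝ (Fin d))).restrict Ω) :=
  WithLp.fstL 2 𝕜 _ _ ∘L (H1 𝕜 Ω).subtypeL ∘L (H10 𝕜 Ω).subtypeL

variable (𝕜 Ω) in
/-- The gradient `H¹₀(Ω) → L²(Ω; 𝕜ᵈ)`. -/
noncomputable def gradPartL :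
    H10 𝕜 Ω →L[𝕜] Lp (EuclideanSpace 𝕜 (Fin d)) 2
      ((volume : Measure (EuclideanSpace ℝ (Fin d))).restrict Ω) :=
  WithLp.sndL 2 𝕜 _ _ ∘L (H1 𝕜 Ω).subtypeL ∘L (H10 𝕜 Ω).subtypeL

theorem fnPartL_apply (U : H10 𝕜 Ω) : fnPartL 𝕜 Ω U = fnPart (U : H1 𝕜 Ω) := rfl

theorem gradPartL_apply (U : H10 𝕜 Ω) : gradPartL 𝕜 Ω U = gradPart (U : H1 𝕜 Ω) := rfl

/-! ### Gradients of test functions and of their limits -/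

/-- The classical gradient, as the vector of partial derivatives. -/
noncomputable def classicalGrad (φ : EuclideanSpace ℝ (Fin d) → 𝕜) (x : EuclideanSpace ℝ (Fin d)) :
    EuclideanSpace 𝕜 (Fin d) :=
  WithLp.toLp 2 fun i => fderiv ℝ φ x (EuclideanSpace.single i 1)

/-- The directional derivative is the inner product of the gradient with `h` viewed in `𝕜ᵈ`, so
Cauchy–Schwarz applies. -/
theorem norm_fderiv_apply_le_classicalGrad (φ : EuclideanSpace ℝ (Fin d) → 𝕜)
    (x h : EuclideanSpace ℝ (Fin d)) : ‖fderiv ℝ φ x h‖ ≤ ‖h‖ * ‖classicalGrad φ x‖ := by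
  have e : fderiv ℝ φ x h
      = inner 𝕜 (WithLp.toLp 2 fun i => ((h i : ℝ) : 𝕜) : EuclideanSpace 𝕜 (Fin d))
          (classicalGrad φ x) := by
    have hh : h = ∑ i, h i • EuclideanSpace.single i (1 : ℝ) := by
      simpa using ((EuclideanSpace.basisFun (Fin d) ℝ).sum_repr h).symm
    conv_lhs => rw [hh]
    rw [map_sum, PiLp.inner_apply]
    refine Finset.sum_congr rfl fun i _ => ?_
    rw [map_smul, RCLike.inner_apply, RCLike.conj_ofReal, RCLike.real_smul_eq_coe_mul, mul_comm]
    rfl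
  have e2 : ‖(WithLp.toLp 2 fun i => ((h i : ℝ) : 𝕜) : EuclideanSpace 𝕜 (Fin d))‖ = ‖h‖ := by
    simp [EuclideanSpace.norm_eq]
  rw [e, ← e2]
  exact norm_inner_le_norm _ _

theorem continuous_classicalGrad {φ : EuclideanSpace ℝ (Fin d) → 𝕜} (hφ : ContDiff ℝ 1 φ) :
    Continuous (classicalGrad φ) := by
  refine (PiLp.continuous_toLp 2 _).comp (continuous_pi fun i => ?_)
  exact (hφ.continuous_fderiv (by simp)).clm_apply continuous_const

/-- The support of `φ` lies in `Ω`, so both integrals extend to the whole space, where integration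
by parts has no boundary term. Consequently `g` need not vanish near the boundary of `Ω`. -/
theorem integral_fderiv_smul_test {φ : EuclideanSpace ℝ (Fin d) → 𝕜} (hφ : ContDiff ℝ 1 φ)
    (hφs : tsupport φ ⊆ Ω) {g : EuclideanSpace ℝ (Fin d) → ℝ}
    (hg : ContDiff ℝ 1 g) (hc : HasCompactSupport g) (i : Fin d) :
    ∫ x in (Ω : Set (EuclideanSpace ℝ (Fin d))),
        (fderiv ℝ g x (EuclideanSpace.single i 1)) • φ x
      = - ∫ x in (Ω : Set (EuclideanSpace ℝ (Fin d))), g x • classicalGrad φ x i := by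
  have hd : Continuous fun x => fderiv ℝ g x (EuclideanSpace.single i 1) :=
    (hg.continuous_fderiv (by simp)).clm_apply continuous_const
  have hdc : HasCompactSupport fun x => fderiv ℝ g x (EuclideanSpace.single i 1) :=
    hc.fderiv_apply (𝕜 := ℝ) _
  have hdφ : Continuous fun x => fderiv ℝ φ x (EuclideanSpace.single i 1) :=
    (hφ.continuous_fderiv (by simp)).clm_apply continuous_const
  rw [setIntegral_eq_integral_of_forall_compl_eq_zero, setIntegral_eq_integral_of_forall_compl_eq_zero]
  · have := integral_bilinear_fderiv_right_eq_neg_left_of_integrable (μ := volume)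
      (f := g) (g := φ) (v := EuclideanSpace.single i 1)
      (B := ContinuousLinearMap.lsmul ℝ ℝ)
      ((hd.smul hφ.continuous).integrable_of_hasCompactSupport hdc.smul_right)
      ((hg.continuous.smul hdφ).integrable_of_hasCompactSupport hc.smul_right)
      ((hg.continuous.smul hφ.continuous).integrable_of_hasCompactSupport hc.smul_right)
      (fun x _ => hg.differentiable (by simp) x) (fun x _ => hφ.differentiable (by simp) x)
    simp only [ContinuousLinearMap.lsmul_apply] at this
    rw [eq_neg_iff_add_eq_zero, add_comm, ← eq_neg_iff_add_eq_zero]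
    exact this
  · intro x hx
    have h0 : fderiv ℝ φ x = 0 := by
      by_contra h
      exact hx (hφs (support_fderiv_subset ℝ h))
    simp [classicalGrad, h0]
  · intro x hx
    have h0 : φ x = 0 := by
      by_contra h
      exact hx (hφs (subset_tsupport _ h))
    simp [h0]

/-- Uniqueness of weak gradients: the difference of the two integrates to zero against every test
function in `Ω`, hence vanishes almost everywhere. -/
theorem gradPart_ae_eq_of_test {U : H1 𝕜 Ω} {φ : 𝓓(Ω, 𝕜)}
    (h : fnPart U =ᵐ[(volume : Measure (EuclideanSpace ℝ (Fin d))).restrict Ω] φ) :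
    gradPart U =ᵐ[(volume : Measure (EuclideanSpace ℝ (Fin d))).restrict Ω] classicalGrad φ := by
  have hφ : ContDiff ℝ 1 φ := φ.contDiff.of_le (by simp)
  have key : ∀ i : Fin d, ∀ᵐ x, x ∈ (Ω : Set (EuclideanSpace ℝ (Fin d))) →
      gradPart U x i - classicalGrad φ x i = 0 := by
    intro i
    have hci : Continuous fun x => classicalGrad φ x i :=
      (hφ.continuous_fderiv (by simp)).clm_apply continuous_const
    have hL1 : LocallyIntegrable (fun x => gradPart U x i)
        ((volume : Measure (EuclideanSpace ℝ (Fin d))).restrict Ω) :=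
      ((Lp.memLp (gradPart U)).eval_piLp i).locallyIntegrable (by norm_num)
    refine Ω.isOpen.ae_eq_zero_of_integral_contDiff_smul_eq_zero ?_ ?_
    · refine LocallyIntegrableOn.sub ?_ (hci.locallyIntegrable.locallyIntegrableOn _)
      exact locallyIntegrableOn_of_locallyIntegrable_restrict hL1
    · intro g hg hgc hgs
      have h1 := U.2 ⟨g, hg, hgc, hgs⟩ i
      have h2 := integral_fderiv_smul_test hφ φ.tsupport_subset (hg.of_le (by simp)) hgc i
      have h3 : ∫ x in (Ω : Set (EuclideanSpace ℝ (Fin d))),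
          (fderiv ℝ g x (EuclideanSpace.single i 1)) • fnPart U x
          = ∫ x in (Ω : Set (EuclideanSpace ℝ (Fin d))),
          (fderiv ℝ g x (EuclideanSpace.single i 1)) • φ x := by
        refine integral_congr_ae ?_
        filter_upwards [h] with x hx
        rw [hx]
      have h4 : ∫ x in (Ω : Set (EuclideanSpace ℝ (Fin d))), g x • gradPart U x i
          = ∫ x in (Ω : Set (EuclideanSpace ℝ (Fin d))), g x • classicalGrad φ x i := by
        rw [← neg_inj, ← h2, ← h3]
        exact h1.symm
      rw [← setIntegral_eq_integral_of_forall_compl_eq_zero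
        (s := (Ω : Set (EuclideanSpace ℝ (Fin d)))) (fun x hx => by
          have : g x = 0 := by
            by_contra h
            exact hx (hgs (subset_tsupport _ h))
          simp [this])]
      simp only [smul_sub]
      have hI : Integrable (fun x => g x • classicalGrad φ x i)
          ((volume : Measure (EuclideanSpace ℝ (Fin d))).restrict Ω) :=
        ((hg.continuous.smul hci).integrable_of_hasCompactSupport hgc.smul_right).restrict
      rw [integral_sub (hL1.integrable_smul_left_of_hasCompactSupport hg.continuous hgc) hI, h4,
        sub_self]
  have := (ae_restrict_iff' Ω.isOpen.measurableSet).2 (ae_all_iff.2 key |>.mono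
    fun x hx hxΩ i => hx i hxΩ)
  filter_upwards [this] with x hx
  ext i
  exact sub_eq_zero.1 (hx i)

/-- Unlike in the definition of `H1`, the support of `g` may leave `Ω`; this encodes the zero
boundary values and makes extension by zero possible. The identity holds for test functions and is a
closed condition. -/
theorem weakGradient_identity_of_mem_H10 {U : H1 𝕜 Ω} (hU : U ∈ H10 𝕜 Ω)
    {g : EuclideanSpace ℝ (Fin d) → ℝ} (hg : ContDiff ℝ 1 g) (hc : HasCompactSupport g)
    (i : Fin d) :
    ∫ x in (Ω : Set (EuclideanSpace ℝ (Fin d))),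
        (fderiv ℝ g x (EuclideanSpace.single i 1)) • fnPart U x
      = - ∫ x in (Ω : Set (EuclideanSpace ℝ (Fin d))), g x • gradPart U x i := by
  have hcl := (isClosed_setOf_weakGradient_identity (𝕜 := 𝕜) (Ω := Ω) hg hc i).preimage
    (continuous_subtype_val (p := fun U => U ∈ H1 𝕜 Ω))
  refine closure_minimal ?_ hcl hU
  rintro V ⟨φ, hφ⟩
  have h1 := gradPart_ae_eq_of_test (U := V) hφ
  have h2 := integral_fderiv_smul_test (𝕜 := 𝕜) (Ω := Ω) (φ := φ) (φ.contDiff.of_le (by simp))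
    φ.tsupport_subset hg hc i
  have e1 : ∫ x in (Ω : Set (EuclideanSpace ℝ (Fin d))),
        (fderiv ℝ g x (EuclideanSpace.single i 1)) • (V : L2Pair 𝕜 Ω).fst x
      = ∫ x in (Ω : Set (EuclideanSpace ℝ (Fin d))),
        (fderiv ℝ g x (EuclideanSpace.single i 1)) • φ x := by
    refine integral_congr_ae ?_
    filter_upwards [hφ] with x hx
    rw [hx]
  have e2 : ∫ x in (Ω : Set (EuclideanSpace ℝ (Fin d))), g x • (V : L2Pair 𝕜 Ω).snd x i
      = ∫ x in (Ω : Set (EuclideanSpace ℝ (Fin d))), g x • classicalGrad φ x i := by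
    refine integral_congr_ae ?_
    filter_upwards [h1] with x hx
    rw [← hx]
    rfl
  simp only [Set.mem_preimage, Set.mem_ofPred_eq]
  rw [e1, e2, h2]

end Sobolev

/-! ### Homogeneity, extension by zero and the Sobolev inequality -/

section Extension

variable {𝕜 : Type*} [RCLike 𝕜] {d : ℕ} {Ω : Opens (EuclideanSpace ℝ (Fin d))}

theorem two_lt_critExp (hd : 3 ≤ d) : 2 < critExp d := by
  have h : (3 : ℝ) ≤ d := by exact_mod_cast hd
  rw [critExp, lt_div_iff₀ (by linarith)]
  linarith

theorem critIntegral_smul (hd : 3 ≤ d) (c : 𝕜) (U : H1 𝕜 Ω) :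
    critIntegral (c • U) = ‖c‖ₑ ^ critExp d * critIntegral U := by
  have hq : 0 ≤ critExp d := by linarith [two_lt_critExp hd]
  unfold critIntegral
  rw [← lintegral_const_mul'' _
    ((Lp.aestronglyMeasurable (fnPart U)).enorm.pow_const _)]
  refine lintegral_congr_ae ?_
  filter_upwards [Lp.coeFn_smul c (fnPart U)] with x hx
  have : fnPart (c • U) x = c • fnPart U x := hx
  rw [this, enorm_smul, ENNReal.mul_rpow_of_nonneg _ _ hq]

theorem fnPart_smul (c : 𝕜) (U : H1 𝕜 Ω) : fnPart (c • U) = c • fnPart U := rfl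

theorem gradPart_smul (c : 𝕜) (U : H1 𝕜 Ω) : gradPart (c • U) = c • gradPart U := rfl

theorem restrict_coe_top :
    (volume : Measure (EuclideanSpace ℝ (Fin d))).restrict
      ((⊤ : Opens (EuclideanSpace ℝ (Fin d))) : Set (EuclideanSpace ℝ (Fin d))) = volume := by
  rw [Opens.coe_top, Measure.restrict_univ]

theorem ae_coe_top {p : EuclideanSpace ℝ (Fin d) → Prop}
    (h : ∀ᵐ x ∂(volume : Measure (EuclideanSpace ℝ (Fin d))).restrict
      ((⊤ : Opens (EuclideanSpace ℝ (Fin d))) : Set (EuclideanSpace ℝ (Fin d))), p x) :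
    ∀ᵐ x, p x := by
  rwa [restrict_coe_top] at h

theorem setIntegral_coe_top {F : Type*} [NormedAddCommGroup F] [NormedSpace ℝ F]
    (f : EuclideanSpace ℝ (Fin d) → F) :
    ∫ x in ((⊤ : Opens (EuclideanSpace ℝ (Fin d))) : Set (EuclideanSpace ℝ (Fin d))), f x
      = ∫ x, f x := by
  rw [restrict_coe_top]

theorem setLIntegral_coe_top (f : EuclideanSpace ℝ (Fin d) → ℝ≥0∞) :
    ∫⁻ x in ((⊤ : Opens (EuclideanSpace ℝ (Fin d))) : Set (EuclideanSpace ℝ (Fin d))), f x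
      = ∫⁻ x, f x := by
  rw [restrict_coe_top]

theorem memLp_indicator_top {F : Type*} [NormedAddCommGroup F]
    (f : Lp F 2 ((volume : Measure (EuclideanSpace ℝ (Fin d))).restrict Ω)) :
    MemLp ((Ω : Set (EuclideanSpace ℝ (Fin d))).indicator f) 2
      ((volume : Measure (EuclideanSpace ℝ (Fin d))).restrict
        ((⊤ : Opens (EuclideanSpace ℝ (Fin d))) : Set (EuclideanSpace ℝ (Fin d)))) := by
  rw [restrict_coe_top, memLp_indicator_iff_restrict Ω.isOpen.measurableSet]
  exact Lp.memLp f

/-- Extension by zero of a square-integrable function to the whole space. -/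
noncomputable def zeroExtend {F : Type*} [NormedAddCommGroup F]
    (f : Lp F 2 ((volume : Measure (EuclideanSpace ℝ (Fin d))).restrict Ω)) :
    Lp F 2 ((volume : Measure (EuclideanSpace ℝ (Fin d))).restrict
        ((⊤ : Opens (EuclideanSpace ℝ (Fin d))) : Set (EuclideanSpace ℝ (Fin d)))) :=
  (memLp_indicator_top f).toLp _

theorem coeFn_zeroExtend {F : Type*} [NormedAddCommGroup F]
    (f : Lp F 2 ((volume : Measure (EuclideanSpace ℝ (Fin d))).restrict Ω)) :
    zeroExtend f =ᵐ[volume] (Ω : Set (EuclideanSpace ℝ (Fin d))).indicator f :=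
  ae_coe_top (memLp_indicator_top f).coeFn_toLp

theorem norm_zeroExtend {F : Type*} [NormedAddCommGroup F]
    (f : Lp F 2 ((volume : Measure (EuclideanSpace ℝ (Fin d))).restrict Ω)) :
    ‖zeroExtend f‖ = ‖f‖ := by
  rw [zeroExtend, Lp.norm_toLp, Lp.norm_def, restrict_coe_top,
    eLpNorm_indicator_eq_eLpNorm_restrict Ω.isOpen.measurableSet]

/-- Extension by zero maps `H¹₀(Ω)` to `H¹(ℝᵈ)`. -/
theorem zeroExtend_mem_H1 {U : H1 𝕜 Ω} (hU : U ∈ H10 𝕜 Ω) :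
    (WithLp.toLp 2 (zeroExtend (fnPart U), zeroExtend (gradPart U)) : L2Pair 𝕜 ⊤) ∈ H1 𝕜 ⊤ := by
  intro ψ i
  have h := weakGradient_identity_of_mem_H10 hU (ψ.contDiff.of_le (by simp)) ψ.hasCompactSupport i
  rw [setIntegral_coe_top, setIntegral_coe_top]
  have e1 : ∫ x, (fderiv ℝ ψ x (EuclideanSpace.single i 1)) • zeroExtend (fnPart U) x
      = ∫ x in (Ω : Set (EuclideanSpace ℝ (Fin d))),
        (fderiv ℝ ψ x (EuclideanSpace.single i 1)) • fnPart U x := by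
    rw [← integral_indicator Ω.isOpen.measurableSet]
    refine integral_congr_ae ?_
    filter_upwards [coeFn_zeroExtend (fnPart U)] with x hx
    rw [hx, Set.indicator_smul_apply]
  have e2 : ∫ x, ψ x • zeroExtend (gradPart U) x i
      = ∫ x in (Ω : Set (EuclideanSpace ℝ (Fin d))), ψ x • gradPart U x i := by
    rw [← integral_indicator Ω.isOpen.measurableSet]
    refine integral_congr_ae ?_
    filter_upwards [coeFn_zeroExtend (gradPart U)] with x hx
    rw [hx]
    by_cases hxΩ : x ∈ (Ω : Set (EuclideanSpace ℝ (Fin d)))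
    · simp only [Set.indicator_of_mem hxΩ]
    · simp only [Set.indicator_of_notMem hxΩ, PiLp.zero_apply, smul_zero]
  exact e1.trans (h.trans (congrArg Neg.neg e2.symm))

/-- The **Sobolev inequality** on `H¹₀(Ω)` with the constant of the whole space. -/
theorem critIntegral_le_sobolevConst_mul (hd : 3 ≤ d) {U : H1 𝕜 Ω} (hU : U ∈ H10 𝕜 Ω)
    (h0 : gradPart U ≠ 0) :
    critIntegral U ≤ sobolevConst 𝕜 d * ENNReal.ofReal ‖gradPart U‖ ^ critExp d := by
  have hq : 0 < critExp d := by linarith [two_lt_critExp hd]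
  have hpos : 0 < ‖gradPart U‖ := norm_pos_iff.2 h0
  let V : H1 𝕜 (⊤ : Opens (EuclideanSpace ℝ (Fin d))) := ⟨_, zeroExtend_mem_H1 hU⟩
  have hVg : gradPart V = zeroExtend (gradPart U) := rfl
  have hVf : fnPart V = zeroExtend (fnPart U) := rfl
  have hcrit : critIntegral V = critIntegral U := by
    unfold critIntegral
    rw [hVf, setLIntegral_coe_top, ← lintegral_indicator Ω.isOpen.measurableSet]
    refine lintegral_congr_ae ?_
    filter_upwards [coeFn_zeroExtend (fnPart U)] with x hx
    rw [hx]
    by_cases hxΩ : x ∈ (Ω : Set (EuclideanSpace ℝ (Fin d)))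
    · simp only [Set.indicator_of_mem hxΩ]
    · simp only [Set.indicator_of_notMem hxΩ, enorm_zero, ENNReal.zero_rpow_of_pos hq]
  -- Divided by its gradient norm, the extension competes in the supremum defining `S`; homogeneity
  -- of degree `q` then undoes the scaling.
  set c : 𝕜 := ((‖gradPart U‖⁻¹ : ℝ) : 𝕜) with hc
  have hcn : ‖c‖ = ‖gradPart U‖⁻¹ := by
    rw [hc, RCLike.norm_ofReal, abs_of_pos (inv_pos.2 hpos)]
  have hle : critIntegral (c • V) ≤ sobolevConst 𝕜 d := by
    refine le_iSup₂ (f := fun (u : H1 𝕜 (⊤ : Opens (EuclideanSpace ℝ (Fin d))))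
      (_ : u ∈ {u : H1 𝕜 (⊤ : Opens (EuclideanSpace ℝ (Fin d))) | ‖gradPart u‖ = 1}) =>
        critIntegral u) (c • V) ?_
    rw [Set.mem_ofPred_eq, gradPart_smul, norm_smul, hcn, hVg, norm_zeroExtend,
      inv_mul_cancel₀ hpos.ne']
  rw [critIntegral_smul hd, hcrit, ← ofReal_norm, hcn, ENNReal.ofReal_inv_of_pos hpos,
    ENNReal.inv_rpow, mul_comm, ← div_eq_mul_inv] at hle
  refine (ENNReal.div_le_iff ?_ ?_).1 hle
  · exact (ENNReal.rpow_pos (ENNReal.ofReal_pos.2 hpos) ENNReal.ofReal_ne_top).ne'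
  · exact ENNReal.rpow_ne_top_of_nonneg hq.le ENNReal.ofReal_ne_top

/-- The homogeneous form of the definition of the Brézis–Nirenberg constant. -/
theorem critIntegral_le_brezisNirenbergConst_mul (hd : 3 ≤ d) {lam : ℝ} {U : H1 𝕜 Ω}
    (hU : U ∈ H10 𝕜 Ω) (h0 : 0 < ‖gradPart U‖ ^ 2 - lam * ‖fnPart U‖ ^ 2) :
    critIntegral U ≤ brezisNirenbergConst 𝕜 Ω lam
      * ENNReal.ofReal (‖gradPart U‖ ^ 2 - lam * ‖fnPart U‖ ^ 2) ^ (critExp d / 2) := by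
  have hq : 0 < critExp d := by linarith [two_lt_critExp hd]
  set t := ‖gradPart U‖ ^ 2 - lam * ‖fnPart U‖ ^ 2 with ht
  -- The form has degree 2, so normalising means dividing by `√t`; this is the origin of the
  -- exponent `q/2`.
  set s := Real.sqrt t with hs
  have hspos : 0 < s := Real.sqrt_pos.2 h0
  have hst : s ^ 2 = t := Real.sq_sqrt h0.le
  set c : 𝕜 := ((s⁻¹ : ℝ) : 𝕜) with hc
  have hcn : ‖c‖ = s⁻¹ := by
    rw [hc, RCLike.norm_ofReal, abs_of_pos (inv_pos.2 hspos)]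
  have hle : critIntegral (c • U) ≤ brezisNirenbergConst 𝕜 Ω lam := by
    refine le_iSup₂ (f := fun (u : H1 𝕜 Ω)
      (_ : u ∈ {u : H1 𝕜 Ω | u ∈ H10 𝕜 Ω ∧ ‖gradPart u‖ ^ 2 - lam * ‖fnPart u‖ ^ 2 = 1}) =>
        critIntegral u) (c • U) ⟨Submodule.smul_mem _ _ hU, ?_⟩
    rw [gradPart_smul, fnPart_smul, norm_smul, norm_smul, hcn]
    have : (s⁻¹ * ‖gradPart U‖) ^ 2 - lam * (s⁻¹ * ‖fnPart U‖) ^ 2 = (s ^ 2)⁻¹ * t := by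
      rw [ht]; ring
    rw [this, hst, inv_mul_cancel₀ h0.ne']
  rw [critIntegral_smul hd, ← ofReal_norm, hcn, ENNReal.ofReal_inv_of_pos hspos,
    ENNReal.inv_rpow, mul_comm, ← div_eq_mul_inv] at hle
  have e : ENNReal.ofReal s ^ critExp d = ENNReal.ofReal t ^ (critExp d / 2) := by
    rw [← hst, ENNReal.ofReal_pow hspos.le, ← ENNReal.rpow_natCast, ← ENNReal.rpow_mul]
    congr 1
    push_cast
    ring
  rw [← e]
  refine (ENNReal.div_le_iff ?_ ?_).1 hle
  · exact (ENNReal.rpow_pos (ENNReal.ofReal_pos.2 hspos) ENNReal.ofReal_ne_top).ne'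
  · exact ENNReal.rpow_ne_top_of_nonneg hq.le ENNReal.ofReal_ne_top

end Extension

/-! ### Translations, ball averages and compactness for smooth functions -/

theorem sq_lintegral_le_measure_univ_mul {α : Type*} [MeasurableSpace α] {μ : Measure α}
    {f : α → ℝ≥0∞} (hf : AEMeasurable f μ) :
    (∫⁻ x, f x ∂μ) ^ 2 ≤ μ Set.univ * ∫⁻ x, f x ^ 2 ∂μ := by
  have h := ENNReal.lintegral_mul_le_Lp_mul_Lq μ Real.HolderConjugate.two_two hf
    (aemeasurable_const (b := (1 : ℝ≥0∞)))
  simp only [Pi.mul_apply, mul_one, ENNReal.one_rpow, lintegral_const, one_mul] at h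
  calc (∫⁻ x, f x ∂μ) ^ 2
      ≤ ((∫⁻ x, f x ^ (2 : ℝ) ∂μ) ^ (1 / (2 : ℝ)) * μ Set.univ ^ (1 / (2 : ℝ))) ^ 2 := by gcongr
    _ = μ Set.univ * ∫⁻ x, f x ^ 2 ∂μ := by
        rw [mul_pow, ← ENNReal.rpow_natCast, ← ENNReal.rpow_natCast, ← ENNReal.rpow_mul,
          ← ENNReal.rpow_mul]
        norm_num
        rw [mul_comm]

theorem ENNReal.sq_add_le (a b : ℝ≥0∞) : (a + b) ^ 2 ≤ 2 * (a ^ 2 + b ^ 2) := by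
  have h := ENNReal.rpow_add_le_mul_rpow_add_rpow a b (p := 2) (by norm_num)
  have e : (2 : ℝ) - 1 = 1 := by norm_num
  rw [e, ENNReal.rpow_one] at h
  exact_mod_cast h

section Translation

variable {𝕜 : Type*} [RCLike 𝕜] {d : ℕ} {φ : EuclideanSpace ℝ (Fin d) → 𝕜}

/-- `‖φ(· + h) - φ‖₂ ≤ |h| ‖∇φ‖₂`. -/
theorem lintegral_enorm_translate_sub_sq_le (hφ : ContDiff ℝ 1 φ) (h : EuclideanSpace ℝ (Fin d)) :
    ∫⁻ x, ‖φ (x + h) - φ x‖ₑ ^ 2 ≤ ‖h‖ₑ ^ 2 * ∫⁻ x, ‖classicalGrad φ x‖ₑ ^ 2 := by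
  have hG := continuous_classicalGrad hφ
  -- The fundamental theorem of calculus along the segment from `x` to `x + h`, then Cauchy–Schwarz
  -- in `t`. Tonelli and translation invariance finish the estimate.
  have hpt : ∀ x, ‖φ (x + h) - φ x‖ₑ ^ 2
      ≤ ∫⁻ t in Set.Ioc (0 : ℝ) 1, ‖h‖ₑ ^ 2 * ‖classicalGrad φ (x + t • h)‖ₑ ^ 2 := by
    intro x
    have hder : ∀ t ∈ Set.uIcc (0 : ℝ) 1,
        HasDerivAt (fun t : ℝ => φ (x + t • h)) (fderiv ℝ φ (x + t • h) h) t := by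
      intro t _
      have h1 : HasDerivAt (fun t : ℝ => x + t • h) h t := by
        simpa using ((hasDerivAt_id t).smul_const h).const_add x
      exact ((hφ.differentiable (by simp)) _).hasFDerivAt.comp_hasDerivAt t h1
    have hcont : Continuous fun t : ℝ => fderiv ℝ φ (x + t • h) h :=
      ((hφ.continuous_fderiv (by simp)).comp (by fun_prop)).clm_apply continuous_const
    have e := intervalIntegral.integral_eq_sub_of_hasDerivAt hder (hcont.intervalIntegrable _ _)
    simp only [one_smul, zero_smul, add_zero] at e
    rw [← e, intervalIntegral.integral_of_le zero_le_one]
    calc ‖∫ t in Set.Ioc (0 : ℝ) 1, fderiv ℝ φ (x + t • h) h‖ₑ ^ 2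
        ≤ (∫⁻ t in Set.Ioc (0 : ℝ) 1, ‖fderiv ℝ φ (x + t • h) h‖ₑ) ^ 2 := by
          gcongr
          exact enorm_integral_le_lintegral_enorm _
      _ ≤ (volume.restrict (Set.Ioc (0 : ℝ) 1)) Set.univ
          * ∫⁻ t in Set.Ioc (0 : ℝ) 1, ‖fderiv ℝ φ (x + t • h) h‖ₑ ^ 2 :=
          sq_lintegral_le_measure_univ_mul hcont.enorm.aemeasurable
      _ ≤ _ := by
          simp only [MeasurableSet.univ, Measure.restrict_apply, Set.univ_inter, Real.volume_Ioc,
            sub_zero, ENNReal.ofReal_one, one_mul]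
          refine lintegral_mono fun t => ?_
          rw [← mul_pow]
          gcongr
          have := norm_fderiv_apply_le_classicalGrad φ (x + t • h) h
          rw [← ofReal_norm, ← ofReal_norm, ← ofReal_norm, ← ENNReal.ofReal_mul (norm_nonneg _)]
          exact ENNReal.ofReal_le_ofReal this
  refine (lintegral_mono hpt).trans ?_
  have hm : Measurable fun p : EuclideanSpace ℝ (Fin d) × ℝ =>
      ‖h‖ₑ ^ 2 * ‖classicalGrad φ (p.1 + p.2 • h)‖ₑ ^ 2 := by
    refine Measurable.const_mul (Measurable.pow_const ?_ _) _
    exact (hG.comp (by fun_prop)).enorm.measurable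
  rw [lintegral_lintegral_swap hm.aemeasurable]
  have hinner : ∀ t : ℝ, ∫⁻ x, ‖h‖ₑ ^ 2 * ‖classicalGrad φ (x + t • h)‖ₑ ^ 2
      = ‖h‖ₑ ^ 2 * ∫⁻ x, ‖classicalGrad φ x‖ₑ ^ 2 := by
    intro t
    rw [lintegral_add_right_eq_self (fun x => ‖h‖ₑ ^ 2 * ‖classicalGrad φ x‖ₑ ^ 2) (t • h),
      lintegral_const_mul _ (hG.enorm.measurable.pow_const _)]
  simp only [hinner]
  simp

/-- A function differs from its (unnormalised) ball averages by at most the radius times its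
gradient, in `L²`. -/
theorem lintegral_enorm_sub_ball_integral_sq_le (hφ : ContDiff ℝ 1 φ) {ε : ℝ} :
    ∫⁻ x, ‖∫ h in Metric.ball (0 : EuclideanSpace ℝ (Fin d)) ε, (φ (x + h) - φ x)‖ₑ ^ 2
      ≤ volume (Metric.ball (0 : EuclideanSpace ℝ (Fin d)) ε) ^ 2
        * (ENNReal.ofReal ε ^ 2 * ∫⁻ x, ‖classicalGrad φ x‖ₑ ^ 2) := by
  set B := Metric.ball (0 : EuclideanSpace ℝ (Fin d)) ε with hB
  have hc : Continuous fun p : EuclideanSpace ℝ (Fin d) × EuclideanSpace ℝ (Fin d) =>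
      φ (p.1 + p.2) - φ p.1 := by
    have := hφ.continuous
    fun_prop
  -- One factor `volume B` comes from this Cauchy–Schwarz over the ball, the other from integrating
  -- the translation estimate over `h ∈ B`.
  have hpt : ∀ x, ‖∫ h in B, (φ (x + h) - φ x)‖ₑ ^ 2
      ≤ volume B * ∫⁻ h in B, ‖φ (x + h) - φ x‖ₑ ^ 2 := by
    intro x
    have hcx : Continuous fun h => φ (x + h) - φ x := hc.comp (Continuous.prodMk_right x)
    calc ‖∫ h in B, (φ (x + h) - φ x)‖ₑ ^ 2
        ≤ (∫⁻ h in B, ‖φ (x + h) - φ x‖ₑ) ^ 2 := by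
          gcongr
          exact enorm_integral_le_lintegral_enorm _
      _ ≤ (volume.restrict B) Set.univ * ∫⁻ h in B, ‖φ (x + h) - φ x‖ₑ ^ 2 :=
          sq_lintegral_le_measure_univ_mul hcx.enorm.aemeasurable
      _ = _ := by rw [Measure.restrict_apply_univ]
  refine (lintegral_mono hpt).trans ?_
  have hm : Measurable fun p : EuclideanSpace ℝ (Fin d) × EuclideanSpace ℝ (Fin d) =>
      ‖φ (p.1 + p.2) - φ p.1‖ₑ ^ 2 := hc.enorm.measurable.pow_const _
  rw [lintegral_const_mul _ hm.lintegral_prod_right', lintegral_lintegral_swap hm.aemeasurable,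
    pow_two (volume B), mul_assoc]
  gcongr
  calc ∫⁻ h in B, ∫⁻ x, ‖φ (x + h) - φ x‖ₑ ^ 2
      ≤ ∫⁻ _ in B, ENNReal.ofReal ε ^ 2 * ∫⁻ x, ‖classicalGrad φ x‖ₑ ^ 2 := by
        refine setLIntegral_mono measurable_const fun h hh => ?_
        refine (lintegral_enorm_translate_sub_sq_le hφ h).trans ?_
        gcongr
        rw [← ofReal_norm]
        refine ENNReal.ofReal_le_ofReal ?_
        exact (mem_ball_zero_iff.1 hh).le
    _ = _ := by rw [setLIntegral_const, mul_comm]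

/-- Integrating `φ x = φ (x + h) - (φ (x + h) - φ x)` over the ball separates an average, which weak
convergence controls for fixed `ε`, from an error of order `ε` governed by the gradient. -/
theorem measure_ball_sq_mul_lintegral_enorm_sq_le (hφ : ContDiff ℝ 1 φ)
    {s : Set (EuclideanSpace ℝ (Fin d))} {ε : ℝ} :
    volume (Metric.ball (0 : EuclideanSpace ℝ (Fin d)) ε) ^ 2 * ∫⁻ x in s, ‖φ x‖ₑ ^ 2
      ≤ 2 * (∫⁻ x in s, ‖∫ h in Metric.ball (0 : EuclideanSpace ℝ (Fin d)) ε, φ (x + h)‖ₑ ^ 2)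
        + 2 * (volume (Metric.ball (0 : EuclideanSpace ℝ (Fin d)) ε) ^ 2
          * (ENNReal.ofReal ε ^ 2 * ∫⁻ x, ‖classicalGrad φ x‖ₑ ^ 2)) := by
  set B := Metric.ball (0 : EuclideanSpace ℝ (Fin d)) ε with hB
  have hBfin : volume B ≠ ⊤ := measure_ball_lt_top.ne
  have hφc := hφ.continuous
  have hpt : ∀ x, volume B ^ 2 * ‖φ x‖ₑ ^ 2
      ≤ 2 * (‖∫ h in B, φ (x + h)‖ₑ ^ 2 + ‖∫ h in B, (φ (x + h) - φ x)‖ₑ ^ 2) := by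
    intro x
    refine le_trans ?_ (ENNReal.sq_add_le _ _)
    rw [← mul_pow]
    gcongr
    have hcx : Continuous fun h => φ (x + h) := by fun_prop
    have hint : Integrable (fun h => φ (x + h)) (volume.restrict B) :=
      (hcx.continuousOn.integrableOn_compact (isCompact_closedBall 0 ε)).mono_set
        Metric.ball_subset_closedBall
    have e : volume.real B • φ x = (∫ h in B, φ (x + h)) - ∫ h in B, (φ (x + h) - φ x) := by
      rw [integral_sub hint (integrableOn_const hBfin)]
      simp
    calc volume B * ‖φ x‖ₑ = ‖volume.real B • φ x‖ₑ := by
          rw [enorm_smul, Measure.real, Real.enorm_eq_ofReal ENNReal.toReal_nonneg,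
            ENNReal.ofReal_toReal hBfin]
      _ ≤ _ := by
          rw [e]
          exact enorm_sub_le
  have hmF : Measurable fun x => ‖∫ h in B, φ (x + h)‖ₑ ^ 2 := by
    have : StronglyMeasurable fun x => ∫ h in B, φ (x + h) := by
      have hc : Continuous fun p : EuclideanSpace ℝ (Fin d) × EuclideanSpace ℝ (Fin d) =>
        φ (p.1 + p.2) := by fun_prop
      exact hc.stronglyMeasurable.integral_prod_right'
    exact this.enorm.pow_const _
  calc volume B ^ 2 * ∫⁻ x in s, ‖φ x‖ₑ ^ 2
      = ∫⁻ x in s, volume B ^ 2 * ‖φ x‖ₑ ^ 2 :=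
        (lintegral_const_mul _ (hφc.enorm.measurable.pow_const _)).symm
    _ ≤ ∫⁻ x in s, 2 * (‖∫ h in B, φ (x + h)‖ₑ ^ 2 + ‖∫ h in B, (φ (x + h) - φ x)‖ₑ ^ 2) :=
        lintegral_mono hpt
    _ = 2 * (∫⁻ x in s, ‖∫ h in B, φ (x + h)‖ₑ ^ 2)
        + 2 * ∫⁻ x in s, ‖∫ h in B, (φ (x + h) - φ x)‖ₑ ^ 2 := by
        rw [lintegral_const_mul' _ _ (by simp), lintegral_add_left hmF, mul_add]
    _ ≤ _ := by
        gcongr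
        exact (setLIntegral_le_lintegral _ _).trans (lintegral_enorm_sub_ball_integral_sq_le hφ)

open Filter Topology in
/-- A form of the **Rellich theorem**: if smooth functions supported in a bounded set are bounded
in `H¹` and their integrals over all balls tend to zero, then they tend to zero in `L²`. -/
theorem tendsto_lintegral_enorm_sq_of_tendsto_setIntegral_ball
    {s : Set (EuclideanSpace ℝ (Fin d))} (hs : Bornology.IsBounded s) (hsm : MeasurableSet s)
    {φ : ℕ → EuclideanSpace ℝ (Fin d) → 𝕜} (hφ : ∀ n, ContDiff ℝ 1 (φ n))
    (hφs : ∀ n, ∀ x ∉ s, φ n x = 0) {M : ℝ≥0∞} (hM : M ≠ ⊤)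
    (hM0 : ∀ n, ∫⁻ x in s, ‖φ n x‖ₑ ^ 2 ≤ M) (hM1 : ∀ n, ∫⁻ x, ‖classicalGrad (φ n) x‖ₑ ^ 2 ≤ M)
    (hlim : ∀ x r, Tendsto (fun n => ∫ y in Metric.ball x r, φ n y) atTop (𝓝 0)) :
    Tendsto (fun n => ∫⁻ x in s, ‖φ n x‖ₑ ^ 2) atTop (𝓝 0) := by
  have hsfin : volume s ≠ ⊤ := hs.measure_lt_top.ne
  -- For fixed `ε` the averages tend to zero, so only the gradient error survives in the limit
  -- superior; afterwards `ε → 0`.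
  have key : ∀ ε : ℝ, 0 < ε →
      limsup (fun n => ∫⁻ x in s, ‖φ n x‖ₑ ^ 2) atTop ≤ 2 * (ENNReal.ofReal ε ^ 2 * M) := by
    intro ε hε
    set B := Metric.ball (0 : EuclideanSpace ℝ (Fin d)) ε with hB
    have hBfin : volume B ≠ ⊤ := measure_ball_lt_top.ne
    have hBpos : volume B ≠ 0 := (Metric.measure_ball_pos _ _ hε).ne'
    have hshift : ∀ n x, ∫ h in B, φ n (x + h) = ∫ y in Metric.ball x ε, φ n y := by
      intro n x
      have h1 := (measurePreserving_add_left (volume : Measure (EuclideanSpace ℝ (Fin d))) x)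
        |>.setIntegral_preimage_emb (measurableEmbedding_addLeft x) (φ n) (Metric.ball x ε)
      rw [← h1]
      congr 2
      ext h
      simp [hB, Metric.mem_ball]
    have hF : Tendsto (fun n => ∫⁻ x in s, ‖∫ h in B, φ n (x + h)‖ₑ ^ 2) atTop (𝓝 0) := by
      have h0 : (0 : ℝ≥0∞) = ∫⁻ _ in s, (0 : ℝ≥0∞) ∂(volume : Measure (EuclideanSpace ℝ (Fin d))) := by
        simp
      rw [h0]
      -- The averages are bounded by a constant through Cauchy–Schwarz, and a constant is integrable
      -- over `s` because `s` is bounded.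
      refine tendsto_lintegral_of_dominated_convergence (fun _ => volume B * M) (fun n => ?_)
        (fun n => Eventually.of_forall fun x => ?_) ?_ (Eventually.of_forall fun x => ?_)
      · have : StronglyMeasurable fun x => ∫ h in B, φ n (x + h) := by
          have hφc := (hφ n).continuous
          have hc : Continuous fun p : EuclideanSpace ℝ (Fin d) × EuclideanSpace ℝ (Fin d) =>
            φ n (p.1 + p.2) := by fun_prop
          exact hc.stronglyMeasurable.integral_prod_right'
        exact this.enorm.pow_const _
      · have hφc := (hφ n).continuous
        calc ‖∫ h in B, φ n (x + h)‖ₑ ^ 2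
            ≤ (∫⁻ h in B, ‖φ n (x + h)‖ₑ) ^ 2 := by
              gcongr
              exact enorm_integral_le_lintegral_enorm _
          _ ≤ (volume.restrict B) Set.univ * ∫⁻ h in B, ‖φ n (x + h)‖ₑ ^ 2 :=
              sq_lintegral_le_measure_univ_mul (by fun_prop)
          _ ≤ volume B * ∫⁻ h, ‖φ n (x + h)‖ₑ ^ 2 := by
              rw [Measure.restrict_apply_univ]
              gcongr
              exact Measure.restrict_le_self
          _ = volume B * ∫⁻ y, ‖φ n y‖ₑ ^ 2 := by
              rw [lintegral_add_left_eq_self (fun y => ‖φ n y‖ₑ ^ 2)]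
          _ ≤ volume B * M := by
              gcongr
              refine le_trans (le_of_eq ?_) (hM0 n)
              rw [← lintegral_indicator hsm]
              refine lintegral_congr fun y => ?_
              by_cases hy : y ∈ s
              · rw [Set.indicator_of_mem hy]
              · rw [Set.indicator_of_notMem hy, hφs n y hy]
                simp
      · rw [setLIntegral_const]
        exact ENNReal.mul_ne_top (ENNReal.mul_ne_top hBfin hM) hsfin
      · have h1 := ((ENNReal.continuous_pow 2).tendsto _).comp (hlim x ε).enorm
        simp only [hshift]
        simpa [Function.comp_def] using h1
    have hle : ∀ n, ∫⁻ x in s, ‖φ n x‖ₑ ^ 2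
        ≤ (volume B ^ 2)⁻¹ * (2 * (∫⁻ x in s, ‖∫ h in B, φ n (x + h)‖ₑ ^ 2))
          + 2 * (ENNReal.ofReal ε ^ 2 * M) := by
      intro n
      have hB2 : volume B ^ 2 ≠ 0 := pow_ne_zero _ hBpos
      have hB2' : volume B ^ 2 ≠ ⊤ := ENNReal.pow_ne_top hBfin
      have h1 := measure_ball_sq_mul_lintegral_enorm_sq_le (hφ n) (s := s) (ε := ε)
      rw [← hB] at h1
      calc ∫⁻ x in s, ‖φ n x‖ₑ ^ 2
          = (volume B ^ 2)⁻¹ * (volume B ^ 2 * ∫⁻ x in s, ‖φ n x‖ₑ ^ 2) := by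
            rw [← mul_assoc, ENNReal.inv_mul_cancel hB2 hB2', one_mul]
        _ ≤ (volume B ^ 2)⁻¹ * (2 * (∫⁻ x in s, ‖∫ h in B, φ n (x + h)‖ₑ ^ 2)
            + 2 * (volume B ^ 2 * (ENNReal.ofReal ε ^ 2 * M))) := by
            gcongr
            refine h1.trans ?_
            gcongr
            exact hM1 n
        _ = _ := by
            rw [mul_add]
            congr 1
            rw [mul_left_comm, ← mul_assoc (volume B ^ 2)⁻¹, ENNReal.inv_mul_cancel hB2 hB2',
              one_mul]
    have hrhs : Tendsto (fun n => (volume B ^ 2)⁻¹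
          * (2 * (∫⁻ x in s, ‖∫ h in B, φ n (x + h)‖ₑ ^ 2))
          + 2 * (ENNReal.ofReal ε ^ 2 * M)) atTop
          (𝓝 ((volume B ^ 2)⁻¹ * (2 * 0) + 2 * (ENNReal.ofReal ε ^ 2 * M))) := by
      refine Tendsto.add_const _ (ENNReal.Tendsto.const_mul
        (ENNReal.Tendsto.const_mul hF (Or.inr (by simp))) (Or.inr ?_))
      exact ENNReal.inv_ne_top.2 (pow_ne_zero _ hBpos)
    rw [mul_zero, mul_zero, zero_add] at hrhs
    rw [← hrhs.limsup_eq]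
    exact limsup_le_limsup (Eventually.of_forall hle)
  have hzero : limsup (fun n => ∫⁻ x in s, ‖φ n x‖ₑ ^ 2) atTop ≤ 0 := by
    have h1 : Tendsto (fun ε : ℝ => 2 * (ENNReal.ofReal ε ^ 2 * M)) (𝓝[>] 0)
        (𝓝 (2 * (ENNReal.ofReal 0 ^ 2 * M))) := by
      refine Tendsto.mono_left ?_ nhdsWithin_le_nhds
      refine ENNReal.Tendsto.const_mul (ENNReal.Tendsto.mul_const ?_ (Or.inr hM)) (Or.inr (by simp))
      exact ((ENNReal.continuous_pow 2).comp ENNReal.continuous_ofReal).tendsto 0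
    have h2 : (2 * (ENNReal.ofReal 0 ^ 2 * M)) = 0 := by simp
    rw [h2] at h1
    exact ge_of_tendsto h1 (eventually_nhdsWithin_of_forall fun ε hε => key ε hε)
  exact tendsto_of_le_liminf_of_limsup_le zero_le hzero

end Translation

/-! ### Rellich's theorem and the first eigenvalue -/

theorem MeasureTheory.Lp.lintegral_enorm_sq {α F : Type*} [MeasurableSpace α] {μ : Measure α}
    [NormedAddCommGroup F] (f : Lp F 2 μ) : ∫⁻ x, ‖f x‖ₑ ^ 2 ∂μ = ‖f‖ₑ ^ 2 := by
  have h := eLpNorm_nnreal_pow_eq_lintegral (f := f) (μ := μ) (p := 2) (by norm_num)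
  rw [Lp.enorm_def]
  simpa using h.symm

open Filter Topology in
/-- A bounded operator maps a sequence asymptotic to a weakly null one to a weakly null one. -/
theorem tendsto_inner_map_of_weak_tendsto_zero {𝕜 H F : Type*} [RCLike 𝕜] [NormedAddCommGroup H]
    [InnerProductSpace 𝕜 H] [CompleteSpace H] [NormedAddCommGroup F] [InnerProductSpace 𝕜 F]
    [CompleteSpace F] (J : H →L[𝕜] F) {u V : ℕ → H}
    (hw : ∀ v, Tendsto (fun n => inner 𝕜 v (u n)) atTop (𝓝 0))
    (hd : Tendsto (fun n => u n - V n) atTop (𝓝 0)) (g : F) :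
    Tendsto (fun n => inner 𝕜 g (J (V n))) atTop (𝓝 0) := by
  have h1 := hw (J.adjoint g)
  simp only [ContinuousLinearMap.adjoint_inner_left] at h1
  have h2 : Tendsto (fun n => inner 𝕜 g (J (u n - V n))) atTop (𝓝 (inner 𝕜 g (J 0))) :=
    ((continuous_const.inner J.continuous).tendsto 0).comp hd
  rw [map_zero, inner_zero_right] at h2
  simpa [inner_sub_right] using h1.sub h2

section Rellich

variable {𝕜 : Type*} [RCLike 𝕜] {d : ℕ} {Ω : Opens (EuclideanSpace ℝ (Fin d))}

noncomputable instance : NormedAddCommGroup (H1 𝕜 Ω) := Submodule.normedAddCommGroup _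

noncomputable instance : InnerProductSpace 𝕜 (H1 𝕜 Ω) := Submodule.innerProductSpace _

noncomputable instance : NormedAddCommGroup (H10 𝕜 Ω) := Submodule.normedAddCommGroup _

noncomputable instance : InnerProductSpace 𝕜 (H10 𝕜 Ω) := Submodule.innerProductSpace _

theorem testFunction_eq_zero_of_notMem (φ : 𝓓(Ω, 𝕜)) {x : EuclideanSpace ℝ (Fin d)}
    (hx : x ∉ (Ω : Set (EuclideanSpace ℝ (Fin d)))) : φ x = 0 := by
  by_contra h
  exact hx (φ.tsupport_subset (subset_tsupport _ h))

theorem classicalGrad_testFunction_eq_zero_of_notMem (φ : 𝓓(Ω, 𝕜)) {x : EuclideanSpace ℝ (Fin d)}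
    (hx : x ∉ (Ω : Set (EuclideanSpace ℝ (Fin d)))) : classicalGrad φ x = 0 := by
  have h0 : fderiv ℝ φ x = 0 := by
    by_contra h
    exact hx (φ.tsupport_subset (support_fderiv_subset ℝ h))
  ext i
  simp [classicalGrad, h0]

theorem lintegral_enorm_sq_of_test {U : H1 𝕜 Ω} {φ : 𝓓(Ω, 𝕜)}
    (h : fnPart U =ᵐ[(volume : Measure (EuclideanSpace ℝ (Fin d))).restrict Ω] φ) :
    ∫⁻ x in (Ω : Set (EuclideanSpace ℝ (Fin d))), ‖φ x‖ₑ ^ 2 = ‖fnPart U‖ₑ ^ 2 := by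
  rw [← Lp.lintegral_enorm_sq]
  refine lintegral_congr_ae ?_
  filter_upwards [h] with x hx
  rw [hx]

theorem lintegral_enorm_classicalGrad_sq_of_test {U : H1 𝕜 Ω} {φ : 𝓓(Ω, 𝕜)}
    (h : fnPart U =ᵐ[(volume : Measure (EuclideanSpace ℝ (Fin d))).restrict Ω] φ) :
    ∫⁻ x, ‖classicalGrad φ x‖ₑ ^ 2 = ‖gradPart U‖ₑ ^ 2 := by
  have e : ∫⁻ x, ‖classicalGrad φ x‖ₑ ^ 2
      = ∫⁻ x in (Ω : Set (EuclideanSpace ℝ (Fin d))), ‖classicalGrad φ x‖ₑ ^ 2 := by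
    rw [← lintegral_indicator Ω.isOpen.measurableSet]
    refine lintegral_congr fun x => ?_
    by_cases hx : x ∈ (Ω : Set (EuclideanSpace ℝ (Fin d)))
    · rw [Set.indicator_of_mem hx]
    · rw [Set.indicator_of_notMem hx, classicalGrad_testFunction_eq_zero_of_notMem φ hx]
      simp
  rw [e, ← Lp.lintegral_enorm_sq]
  refine lintegral_congr_ae ?_
  filter_upwards [gradPart_ae_eq_of_test h] with x hx
  rw [hx]

theorem restrict_ball_ne_top (x : EuclideanSpace ℝ (Fin d)) (r : ℝ) :
    ((volume : Measure (EuclideanSpace ℝ (Fin d))).restrict Ω) (Metric.ball x r) ≠ ⊤ :=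
  ((Measure.restrict_apply_le _ _).trans_lt measure_ball_lt_top).ne

/-- This exhibits ball integrals as bounded functionals on `L²(Ω)`, so that they vanish along weakly
null sequences. The ball may leave `Ω`, since `φ` is zero there. -/
theorem setIntegral_ball_eq_inner_of_test {U : H1 𝕜 Ω} {φ : 𝓓(Ω, 𝕜)}
    (h : fnPart U =ᵐ[(volume : Measure (EuclideanSpace ℝ (Fin d))).restrict Ω] φ)
    {x : EuclideanSpace ℝ (Fin d)} {r : ℝ} :
    ∫ y in Metric.ball x r, φ y
      = inner 𝕜 (indicatorConstLp 2 measurableSet_ball (restrict_ball_ne_top (Ω := Ω) x r) (1 : 𝕜))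
          (fnPart U) := by
  rw [L2.inner_indicatorConstLp_one, Measure.restrict_restrict measurableSet_ball, Set.inter_comm,
    ← Measure.restrict_restrict Ω.isOpen.measurableSet,
    ← setIntegral_eq_integral_of_forall_compl_eq_zero
      (s := (Ω : Set (EuclideanSpace ℝ (Fin d))))
      (fun y hy => testFunction_eq_zero_of_notMem φ hy)]
  refine integral_congr_ae ?_
  have h1 := ae_restrict_of_ae (s := Metric.ball x r) h
  rw [Measure.restrict_restrict measurableSet_ball, Set.inter_comm,
    ← Measure.restrict_restrict Ω.isOpen.measurableSet] at h1
  filter_upwards [h1] with y hy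
  rw [hy]

theorem enorm_sq_le_of_norm_le {F : Type*} [NormedAddCommGroup F] {f : F} {R : ℝ} (h : ‖f‖ ≤ R) :
    ‖f‖ₑ ^ 2 ≤ ENNReal.ofReal R ^ 2 := by
  gcongr
  rw [← ofReal_norm]
  exact ENNReal.ofReal_le_ofReal h

set_option maxHeartbeats 1000000 in
open Filter Topology in
/-- **Rellich's theorem**: on a bounded open set the embedding `H¹₀(Ω) → L²(Ω)` maps bounded weakly
null sequences to null sequences. -/
theorem tendsto_fnPartL_of_weak_tendsto_zero
    (hΩ : Bornology.IsBounded (Ω : Set (EuclideanSpace ℝ (Fin d)))) (u : ℕ → H10 𝕜 Ω) (R : ℝ)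
    (hu : ∀ n, ‖u n‖ ≤ R) (hw : ∀ v, Tendsto (fun n => inner 𝕜 v (u n)) atTop (𝓝 0)) :
    Tendsto (fun n => fnPartL 𝕜 Ω (u n)) atTop (𝓝 0) := by
  -- The compactness argument needs smooth functions, so `u n` is replaced by a test function within
  -- `1/(n+1)` in `H¹`; the error tends to zero and affects neither hypothesis nor conclusion.
  have hex : ∀ n : ℕ, ∃ V : H10 𝕜 Ω, (V : H1 𝕜 Ω) ∈ testH1 𝕜 Ω ∧
      ‖u n - V‖ ≤ 1 / ((n : ℝ) + 1) := by
    intro n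
    have hcl : ((u n : H10 𝕜 Ω) : H1 𝕜 Ω) ∈ closure (testH1 𝕜 Ω : Set (H1 𝕜 Ω)) := (u n).2
    obtain ⟨V, hV, hVd⟩ := Metric.mem_closure_iff.1 hcl (1 / ((n : ℝ) + 1)) (by positivity)
    refine ⟨⟨V, Submodule.le_topologicalClosure _ hV⟩, hV, ?_⟩
    rw [dist_eq_norm] at hVd
    exact hVd.le
  choose V hV hVu using hex
  choose φ hφ using hV
  have hdiff : Tendsto (fun n => u n - V n) atTop (𝓝 0) :=
    squeeze_zero_norm hVu (tendsto_one_div_add_atTop_nhds_zero_nat (𝕜 := ℝ))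
  have hφ' : ∀ n, fnPart (V n : H1 𝕜 Ω)
      =ᵐ[(volume : Measure (EuclideanSpace ℝ (Fin d))).restrict Ω] φ n := hφ
  have hVn : ∀ n, ‖(V n : H1 𝕜 Ω)‖ ≤ R + 1 := by
    intro n
    have h1 : ‖V n‖ ≤ ‖u n‖ + ‖u n - V n‖ := by
      simpa using norm_sub_le (u n) (u n - V n)
    have h2 : 1 / ((n : ℝ) + 1) ≤ 1 := by
      rw [div_le_one (by positivity)]
      linarith [(Nat.cast_nonneg n : (0 : ℝ) ≤ n)]
    have h3 : ‖V n‖ = ‖(V n : H1 𝕜 Ω)‖ := rfl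
    linarith [hu n, hVu n]
  have hL2 : Tendsto (fun n => ∫⁻ x in (Ω : Set (EuclideanSpace ℝ (Fin d))), ‖φ n x‖ₑ ^ 2) atTop
      (𝓝 0) := by
    refine tendsto_lintegral_enorm_sq_of_tendsto_setIntegral_ball hΩ Ω.isOpen.measurableSet
      (fun n => (φ n).contDiff.of_le (by simp))
      (fun n x hx => testFunction_eq_zero_of_notMem (φ n) hx)
      (M := ENNReal.ofReal (R + 1) ^ 2) (ENNReal.pow_ne_top ENNReal.ofReal_ne_top)
      (fun n => ?_) (fun n => ?_) (fun x r => ?_)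
    · rw [lintegral_enorm_sq_of_test (hφ' n)]
      exact enorm_sq_le_of_norm_le ((norm_fnPart_le _).trans (hVn n))
    · rw [lintegral_enorm_classicalGrad_sq_of_test (hφ' n)]
      exact enorm_sq_le_of_norm_le ((norm_gradPart_le _).trans (hVn n))
    · simp only [setIntegral_ball_eq_inner_of_test (hφ' _)]
      exact tendsto_inner_map_of_weak_tendsto_zero (fnPartL 𝕜 Ω) hw hdiff _
  have hJV : Tendsto (fun n => fnPartL 𝕜 Ω (V n)) atTop (𝓝 0) := by
    rw [tendsto_zero_iff_enorm_tendsto_zero]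
    have h1 : Tendsto (fun n => (‖fnPartL 𝕜 Ω (V n)‖ₑ ^ 2) ^ (1 / 2 : ℝ)) atTop
        (𝓝 (0 ^ (1 / 2 : ℝ))) := by
      refine (ENNReal.continuous_rpow_const.tendsto _).comp ?_
      refine hL2.congr fun n => ?_
      rw [lintegral_enorm_sq_of_test (hφ' n), fnPartL_apply]
    rw [ENNReal.zero_rpow_of_pos (by norm_num)] at h1
    refine h1.congr fun n => ?_
    rw [← ENNReal.rpow_natCast, ← ENNReal.rpow_mul]
    norm_num
  have h4 := hJV.add (((fnPartL 𝕜 Ω).continuous.tendsto 0).comp hdiff)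
  simpa using h4

/-- Testing the equation with `u` itself gives `‖∇u‖² = m ‖u‖²`. The lower bound is what makes the
infimum defining `lambda1` meaningful. -/
theorem isDirichletEigenvalue_nonneg {m : ℝ} (h : IsDirichletEigenvalue 𝕜 Ω m) : 0 ≤ m := by
  obtain ⟨u, hu, hu0, h⟩ := h
  have h1 := h u hu
  rw [inner_self_eq_norm_sq_to_K, inner_self_eq_norm_sq_to_K] at h1
  have h2 : ‖gradPart u‖ ^ 2 = m * ‖fnPart u‖ ^ 2 := by exact_mod_cast h1
  by_contra hm
  have h3 : ‖fnPart u‖ ^ 2 = 0 := by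
    by_contra h3
    have : 0 < ‖fnPart u‖ ^ 2 := lt_of_le_of_ne (sq_nonneg _) (Ne.symm h3)
    nlinarith [sq_nonneg ‖gradPart u‖]
  have h4 : ‖u‖ ^ 2 = 0 := by rw [norm_sq_H1, h2, h3]; simp
  exact hu0 (norm_eq_zero.1 (pow_eq_zero_iff (two_ne_zero)|>.1 h4))

set_option maxHeartbeats 1000000 in
/-- The variational characterisation of the first Dirichlet eigenvalue: `λ₁ ‖u‖² ≤ ‖∇u‖²`. -/
theorem lambda1_mul_norm_sq_le (hΩ : Bornology.IsBounded (Ω : Set (EuclideanSpace ℝ (Fin d))))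
    {u : H1 𝕜 Ω} (hu : u ∈ H10 𝕜 Ω) : lambda1 𝕜 Ω * ‖fnPart u‖ ^ 2 ≤ ‖gradPart u‖ ^ 2 := by
  set J := fnPartL 𝕜 Ω with hJdef
  -- In this degenerate case `u` vanishes in `L²`, so the value that `sInf` takes does not matter.
  by_cases hJ : J = 0
  · have : fnPart u = 0 := by
      have := congrArg (fun T => T (⟨u, hu⟩ : H10 𝕜 Ω)) hJ
      simpa [hJdef, fnPartL_apply] using this
    rw [this]
    simp
  have hJpos : 0 < ‖J‖ ^ 2 := by
    have : 0 < ‖J‖ := norm_pos_iff.2 hJ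
    positivity
  obtain ⟨x, hx0, hx⟩ := exists_inner_map_eq_norm_sq (𝕜 := 𝕜) (H := H10 𝕜 Ω) J hJ
    (tendsto_fnPartL_of_weak_tendsto_zero hΩ)
  -- The `H¹` inner product is `⟨v, x⟩ + ⟨∇v, ∇x⟩`, so `⟨v, x⟩ = ‖J‖² (⟨v, x⟩ + ⟨∇v, ∇x⟩)` is the
  -- eigenvalue equation with `m = ‖J‖⁻² - 1`. The operator bound for `J` is the Rayleigh inequality
  -- for the same `m`, and `λ₁ ≤ m`.
  have heig : IsDirichletEigenvalue 𝕜 Ω ((‖J‖ ^ 2)⁻¹ - 1) := by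
    refine ⟨x, x.2, fun h => hx0 (Subtype.ext h), fun v hv => ?_⟩
    have h1 : inner 𝕜 (fnPart v) (fnPart (x : H1 𝕜 Ω)) = ((‖J‖ ^ 2 : ℝ) : 𝕜)
        * (inner 𝕜 (fnPart v) (fnPart (x : H1 𝕜 Ω))
          + inner 𝕜 (gradPart v) (gradPart (x : H1 𝕜 Ω))) := hx ⟨v, hv⟩
    have hne : ((‖J‖ ^ 2 : ℝ) : 𝕜) ≠ 0 := by exact_mod_cast hJpos.ne'
    have aux : ∀ k a b : 𝕜, k ≠ 0 → a = k * (a + b) → b = (k⁻¹ - 1) * a := by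
      intro k a b hk h
      have : k⁻¹ * a = a + b := by
        rw [inv_mul_eq_iff_eq_mul₀ hk]
        exact h
      rw [sub_mul, this]
      ring
    rw [RCLike.ofReal_sub, RCLike.ofReal_inv, RCLike.ofReal_one]
    exact aux _ _ _ hne h1
  have hle : lambda1 𝕜 Ω ≤ (‖J‖ ^ 2)⁻¹ - 1 :=
    csInf_le ⟨0, fun m hm => isDirichletEigenvalue_nonneg hm⟩ heig
  have hbd : ‖fnPart u‖ ≤ ‖J‖ * ‖u‖ := J.le_opNorm ⟨u, hu⟩
  have hbd2 : ‖fnPart u‖ ^ 2 ≤ ‖J‖ ^ 2 * (‖fnPart u‖ ^ 2 + ‖gradPart u‖ ^ 2) := by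
    rw [← norm_sq_H1, ← mul_pow]
    gcongr
  have hbd3 : (‖J‖ ^ 2)⁻¹ * ‖fnPart u‖ ^ 2 ≤ ‖fnPart u‖ ^ 2 + ‖gradPart u‖ ^ 2 := by
    rw [inv_mul_le_iff₀ hJpos]
    exact hbd2
  have h4 := mul_le_mul_of_nonneg_right hle (sq_nonneg ‖fnPart u‖)
  rw [sub_mul, one_mul] at h4
  exact h4.trans (sub_le_iff_le_add'.2 hbd3)

end Rellich

/-! ### Coercivity and splitting along a maximising sequence -/

open Filter Topology in
/-- Along a subsequence of a bounded sequence, a completely continuous operator converges strongly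
and any bounded operator converges weakly. -/
theorem exists_subseq_tendsto_map {𝕜 H F G : Type*} [RCLike 𝕜] [NormedAddCommGroup H]
    [InnerProductSpace 𝕜 H] [CompleteSpace H] [SeparableSpace H]
    [NormedAddCommGroup F] [InnerProductSpace 𝕜 F]
    [NormedAddCommGroup G] [InnerProductSpace 𝕜 G] [CompleteSpace G]
    (J : H →L[𝕜] F) (D : H →L[𝕜] G)
    (hcomp : ∀ (u : ℕ → H) (R : ℝ), (∀ n, ‖u n‖ ≤ R) →
      (∀ v, Tendsto (fun n => inner 𝕜 v (u n)) atTop (𝓝 0)) →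
      Tendsto (fun n => J (u n)) atTop (𝓝 0))
    (u : ℕ → H) (R : ℝ) (hR : ∀ n, ‖u n‖ ≤ R) :
    ∃ (u₀ : H) (φ : ℕ → ℕ), StrictMono φ ∧ Tendsto (fun n => J (u (φ n))) atTop (𝓝 (J u₀)) ∧
      ∀ g, Tendsto (fun n => inner 𝕜 g (D (u (φ n)))) atTop (𝓝 (inner 𝕜 g (D u₀))) := by
  obtain ⟨u₀, φ, hφ, hw⟩ := exists_subseq_weak_tendsto (𝕜 := 𝕜) u R hR
  refine ⟨u₀, φ, hφ, ?_, fun g => ?_⟩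
  · have h1 := hcomp (fun n => u (φ n) - u₀) (R + ‖u₀‖)
      (fun n => (norm_sub_le _ _).trans (by gcongr; exact hR _)) (fun v => by
        have := (hw v).sub_const (inner 𝕜 v u₀)
        simpa [inner_sub_right] using this)
    simpa using h1.add_const (J u₀)
  · have h1 := hw (D.adjoint g)
    simpa only [ContinuousLinearMap.adjoint_inner_left] using h1

section Maximiser

variable {𝕜 : Type*} [RCLike 𝕜] {d : ℕ} {Ω : Opens (EuclideanSpace ℝ (Fin d))}

open Filter Topology in
/-- A bounded sequence in `H¹₀(Ω)` has a subsequence converging in `L²(Ω)` and almost everywhere,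
whose gradients converge weakly. -/
theorem exists_subseq_tendsto_of_bounded_H10
    (hΩ : Bornology.IsBounded (Ω : Set (EuclideanSpace ℝ (Fin d)))) (u : ℕ → H1 𝕜 Ω)
    (hu : ∀ n, u n ∈ H10 𝕜 Ω) (R : ℝ) (hR : ∀ n, ‖u n‖ ≤ R) :
    ∃ u₀ ∈ H10 𝕜 Ω, ∃ φ : ℕ → ℕ, StrictMono φ ∧
      Tendsto (fun n => fnPart (u (φ n))) atTop (𝓝 (fnPart u₀)) ∧
      (∀ᵐ x ∂(volume : Measure (EuclideanSpace ℝ (Fin d))).restrict Ω,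
        Tendsto (fun n => fnPart (u (φ n)) x) atTop (𝓝 (fnPart u₀ x))) ∧
      ∀ g, Tendsto (fun n => inner 𝕜 g (gradPart (u (φ n)))) atTop
        (𝓝 (inner 𝕜 g (gradPart u₀))) := by
  obtain ⟨u₀, φ, hφ, hL2, hw⟩ := exists_subseq_tendsto_map (fnPartL 𝕜 Ω) (gradPartL 𝕜 Ω)
    (tendsto_fnPartL_of_weak_tendsto_zero hΩ) (fun n => ⟨u n, hu n⟩) R hR
  simp only [fnPartL_apply] at hL2
  simp only [gradPartL_apply] at hw
  obtain ⟨ns, hns, hae⟩ := (tendstoInMeasure_of_tendsto_Lp hL2).exists_seq_tendsto_ae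
  exact ⟨u₀, u₀.2, φ ∘ ns, hφ.comp hns, hL2.comp hns.tendsto_atTop, hae,
    fun g => (hw g).comp hns.tendsto_atTop⟩

theorem critIntegral_eq_zero (hd : 3 ≤ d) : critIntegral (0 : H1 𝕜 Ω) = 0 := by
  have h := critIntegral_smul hd (0 : 𝕜) (0 : H1 𝕜 Ω)
  have hq : 0 < critExp d := by linarith [two_lt_critExp hd]
  rwa [smul_zero, enorm_zero, ENNReal.zero_rpow_of_pos hq, zero_mul] at h

-- Truncated subtraction satisfies `a ≤ (a - b) + b` without any finiteness. Brezis–Lieb gives the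
-- limit of the first term when `u` runs along a sequence converging to `v`; the Sobolev inequality
-- bounds the second.
open NNReal in
theorem critIntegral_le_lintegral_sub_add (u v : H1 𝕜 Ω) (c : ℝ≥0) :
    critIntegral u ≤ (∫⁻ x in (Ω : Set (EuclideanSpace ℝ (Fin d))),
        (‖fnPart u x‖ₑ ^ critExp d - c * ‖fnPart u x - fnPart v x‖ₑ ^ critExp d))
      + c * critIntegral (u - v) := by
  have e : c * critIntegral (u - v) = ∫⁻ x in (Ω : Set (EuclideanSpace ℝ (Fin d))),
      c * ‖fnPart u x - fnPart v x‖ₑ ^ critExp d := by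
    unfold critIntegral
    rw [← lintegral_const_mul' _ _ ENNReal.coe_ne_top]
    refine lintegral_congr_ae ?_
    filter_upwards [Lp.coeFn_sub (fnPart u) (fnPart v)] with x hx
    have : fnPart (u - v) x = fnPart u x - fnPart v x := hx
    rw [this]
  have hm : AEMeasurable (fun x => (c : ℝ≥0∞) * ‖fnPart u x - fnPart v x‖ₑ ^ critExp d)
      ((volume : Measure (EuclideanSpace ℝ (Fin d))).restrict Ω) :=
    ((((Lp.aestronglyMeasurable (fnPart u)).sub
      (Lp.aestronglyMeasurable (fnPart v))).enorm.pow_const _).const_mul _)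
  rw [e, ← lintegral_add_right' _ hm]
  exact lintegral_mono fun x => le_tsub_add

/-- Below the first eigenvalue the quadratic form `‖∇u‖² - λ‖u‖²` controls the `H¹` norm. -/
theorem exists_norm_sq_le_mul_form (hΩ : Bornology.IsBounded (Ω : Set (EuclideanSpace ℝ (Fin d))))
    {lam : ℝ} (hlam0 : 0 ≤ lam) (hlam1 : lam < lambda1 𝕜 Ω) :
    ∃ C : ℝ, 0 < C ∧ ∀ u ∈ H10 𝕜 Ω,
      ‖u‖ ^ 2 ≤ C * (‖gradPart u‖ ^ 2 - lam * ‖fnPart u‖ ^ 2) := by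
  set l := lambda1 𝕜 Ω with hl
  have hl0 : 0 < l := hlam0.trans_lt hlam1
  have hsub : 0 < l - lam := sub_pos.2 hlam1
  -- With `a = ‖∇u‖²` and `b = ‖u‖²`, the choice gives `(1+l)(a - λb) - (l-λ)(a+b) = (1+λ)(a - l b)
  -- ≥ 0`.
  refine ⟨(1 + l) / (l - lam), by positivity, fun u hu => ?_⟩
  have h := lambda1_mul_norm_sq_le hΩ hu
  rw [← hl] at h
  rw [norm_sq_H1]
  generalize ‖gradPart u‖ ^ 2 = a at *
  generalize ‖fnPart u‖ ^ 2 = b at *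
  rw [div_mul_eq_mul_div, le_div_iff₀ hsub]
  nlinarith

/-- The **Sobolev inequality** on `H¹₀(Ω)`, in terms of the squared gradient norm. -/
theorem critIntegral_le_sobolevConst_mul_sq (hd : 3 ≤ d)
    (hΩ : Bornology.IsBounded (Ω : Set (EuclideanSpace ℝ (Fin d)))) (hlam : 0 < lambda1 𝕜 Ω)
    {u : H1 𝕜 Ω} (hu : u ∈ H10 𝕜 Ω) :
    critIntegral u ≤ sobolevConst 𝕜 d * ENNReal.ofReal (‖gradPart u‖ ^ 2) ^ (critExp d / 2) := by
  -- A function with zero gradient cannot be normalised; coercivity with `λ = 0`, which is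
  -- Poincaré's inequality, shows that it is zero.
  by_cases h0 : gradPart u = 0
  · obtain ⟨C, -, hC⟩ := exists_norm_sq_le_mul_form hΩ le_rfl hlam
    have h1 := hC u hu
    rw [h0] at h1
    have h2 : u = 0 := by
      rw [← norm_eq_zero, ← sq_eq_zero_iff]
      refine le_antisymm ?_ (sq_nonneg _)
      simpa using h1
    rw [h2, critIntegral_eq_zero hd]
    exact zero_le
  · refine (critIntegral_le_sobolevConst_mul hd hu h0).trans (le_of_eq ?_)
    rw [ENNReal.ofReal_pow (norm_nonneg _), ← ENNReal.rpow_natCast, ← ENNReal.rpow_mul]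
    congr 2
    push_cast
    ring

/-- Coercivity bounds `‖∇u‖²` by a constant on the constraint set, and the Sobolev inequality does
the rest. -/
theorem brezisNirenbergConst_lt_top (hd : 3 ≤ d)
    (hΩ : Bornology.IsBounded (Ω : Set (EuclideanSpace ℝ (Fin d)))) {lam : ℝ} (hlam0 : 0 ≤ lam)
    (hlam1 : lam < lambda1 𝕜 Ω) (hS : sobolevConst 𝕜 d < ⊤) :
    brezisNirenbergConst 𝕜 Ω lam < ⊤ := by
  obtain ⟨C, hC0, hC⟩ := exists_norm_sq_le_mul_form hΩ hlam0 hlam1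
  have hq : 0 < critExp d / 2 := by linarith [two_lt_critExp hd]
  have hle : brezisNirenbergConst 𝕜 Ω lam
      ≤ sobolevConst 𝕜 d * ENNReal.ofReal C ^ (critExp d / 2) := by
    refine iSup₂_le fun u hu => ?_
    refine (critIntegral_le_sobolevConst_mul_sq hd hΩ (hlam0.trans_lt hlam1) hu.1).trans ?_
    gcongr
    have h1 := hC u hu.1
    rw [hu.2, mul_one, norm_sq_H1] at h1
    linarith [sq_nonneg ‖fnPart u‖]
  exact hle.trans_lt (ENNReal.mul_lt_top hS (ENNReal.rpow_lt_top_of_nonneg hq.le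
    ENNReal.ofReal_ne_top))

theorem ENNReal.ofReal_rpow_le_self {t p : ℝ} (ht : t ≤ 1) (hp : 1 ≤ p) :
    ENNReal.ofReal t ^ p ≤ ENNReal.ofReal t := by
  have h := ENNReal.rpow_le_rpow_of_exponent_ge (x := ENNReal.ofReal t)
    (ENNReal.ofReal_le_one.2 ht) hp
  rwa [ENNReal.rpow_one] at h

/-- If `s < L` and `L ≤ L t ^ p + s (1 - t) ^ p` with
`t ∈ [0, 1]`, then `t = 1`. -/
theorem eq_one_of_le_mul_rpow_add {s L : ℝ≥0∞} (hL : L ≠ ⊤) (hsL : s < L) {t p : ℝ} (ht0 : 0 ≤ t)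
    (ht1 : t ≤ 1) (hp : 1 ≤ p)
    (h : L ≤ L * ENNReal.ofReal t ^ p + s * ENNReal.ofReal (1 - t) ^ p) : t = 1 := by
  have hs : s ≠ ⊤ := (hsL.trans (lt_top_iff_ne_top.2 hL)).ne
  -- As `p ≥ 1`, powers of numbers in `[0, 1]` only decrease. The right side becomes a convex
  -- combination of `L` and `s < L`, hence is below `L` unless `t = 1`.
  have h1 : L ≤ L * ENNReal.ofReal t + s * ENNReal.ofReal (1 - t) := by
    refine h.trans ?_
    gcongr
    · exact ENNReal.ofReal_rpow_le_self ht1 hp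
    · exact ENNReal.ofReal_rpow_le_self (by linarith) hp
  have h2 := ENNReal.toReal_mono (ENNReal.add_ne_top.2
    ⟨ENNReal.mul_ne_top hL ENNReal.ofReal_ne_top, ENNReal.mul_ne_top hs ENNReal.ofReal_ne_top⟩) h1
  rw [ENNReal.toReal_add (ENNReal.mul_ne_top hL ENNReal.ofReal_ne_top)
    (ENNReal.mul_ne_top hs ENNReal.ofReal_ne_top), ENNReal.toReal_mul, ENNReal.toReal_mul,
    ENNReal.toReal_ofReal ht0, ENNReal.toReal_ofReal (by linarith)] at h2
  have h3 := (ENNReal.toReal_lt_toReal hs hL).2 hsL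
  nlinarith

open Filter Topology in
/-- Splitting of the quadratic form along a sequence converging in `L²` with weakly converging
gradients. -/
theorem tendsto_norm_gradPart_sub_sq {lam : ℝ} {v : ℕ → H1 𝕜 Ω} {u : H1 𝕜 Ω}
    (hQ : ∀ n, ‖gradPart (v n)‖ ^ 2 - lam * ‖fnPart (v n)‖ ^ 2 = 1)
    (hL2 : Tendsto (fun n => fnPart (v n)) atTop (𝓝 (fnPart u)))
    (hw : ∀ g, Tendsto (fun n => inner 𝕜 g (gradPart (v n))) atTop (𝓝 (inner 𝕜 g (gradPart u)))) :
    Tendsto (fun n => ‖gradPart (v n - u)‖ ^ 2) atTop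
      (𝓝 (1 - (‖gradPart u‖ ^ 2 - lam * ‖fnPart u‖ ^ 2))) := by
  have h1 : Tendsto (fun n => ‖fnPart (v n)‖ ^ 2) atTop (𝓝 (‖fnPart u‖ ^ 2)) := hL2.norm.pow 2
  have h2 : Tendsto (fun n => RCLike.re (inner 𝕜 (gradPart u) (gradPart (v n)))) atTop
      (𝓝 (‖gradPart u‖ ^ 2)) := by
    have := (RCLike.continuous_re.tendsto _).comp (hw (gradPart u))
    rwa [inner_self_eq_norm_sq] at this
  -- In the expansion of `‖∇(v n) - ∇u‖²` the constraint replaces `‖∇(v n)‖²` by `1 + λ‖v n‖²`, so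
  -- strong convergence is needed only in `L²`.
  have h3 := (((h1.const_mul lam).const_add 1).sub (h2.const_mul 2)).add_const (‖gradPart u‖ ^ 2)
  have e : 1 + lam * ‖fnPart u‖ ^ 2 - 2 * ‖gradPart u‖ ^ 2 + ‖gradPart u‖ ^ 2
      = 1 - (‖gradPart u‖ ^ 2 - lam * ‖fnPart u‖ ^ 2) := by ring
  rw [e] at h3
  refine h3.congr fun n => ?_
  have h4 : ‖gradPart (v n - u)‖ ^ 2 = ‖gradPart (v n)‖ ^ 2
      - 2 * RCLike.re (inner 𝕜 (gradPart (v n)) (gradPart u)) + ‖gradPart u‖ ^ 2 :=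
    norm_sub_sq (𝕜 := 𝕜) (gradPart (v n)) (gradPart u)
  rw [h4, inner_re_symm, ← hQ n]
  ring

open Filter Topology NNReal in
/-- Energy splitting for a maximising sequence. -/
theorem le_critIntegral_add_of_tendsto (hd : 3 ≤ d)
    (hΩ : Bornology.IsBounded (Ω : Set (EuclideanSpace ℝ (Fin d)))) (hlam : 0 < lambda1 𝕜 Ω)
    (hS : sobolevConst 𝕜 d < ⊤) {v : ℕ → H1 𝕜 Ω} {u : H1 𝕜 Ω} (hv : ∀ n, v n ∈ H10 𝕜 Ω)
    (hu : u ∈ H10 𝕜 Ω) {b : ℕ → ℝ≥0∞} {L : ℝ≥0∞} (hb : Tendsto b atTop (𝓝 L))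
    (hbv : ∀ n, b n ≤ critIntegral (v n))
    (hae : ∀ᵐ x ∂(volume : Measure (EuclideanSpace ℝ (Fin d))).restrict Ω,
      Tendsto (fun n => fnPart (v n) x) atTop (𝓝 (fnPart u x)))
    {r : ℝ} (hr : Tendsto (fun n => ‖gradPart (v n - u)‖ ^ 2) atTop (𝓝 r)) :
    L ≤ critIntegral u + sobolevConst 𝕜 d * ENNReal.ofReal r ^ (critExp d / 2) := by
  have hq := two_lt_critExp hd
  have hq2 : 0 ≤ critExp d / 2 := by linarith
  have hX : sobolevConst 𝕜 d * ENNReal.ofReal r ^ (critExp d / 2) ≠ ⊤ :=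
    ENNReal.mul_ne_top hS.ne (ENNReal.rpow_ne_top_of_nonneg hq2 ENNReal.ofReal_ne_top)
  have hufin : critIntegral u ≠ ⊤ := ((critIntegral_le_sobolevConst_mul_sq hd hΩ hlam hu).trans_lt
    (ENNReal.mul_lt_top hS (ENNReal.rpow_lt_top_of_nonneg hq2 ENNReal.ofReal_ne_top))).ne
  -- The factor `c > 1` from Brezis–Lieb stays fixed while `n → ∞`; only then does `c → 1`, which
  -- requires the Sobolev term to be finite.
  have key : ∀ c : ℝ≥0, 1 < c →
      L ≤ critIntegral u + c * (sobolevConst 𝕜 d * ENNReal.ofReal r ^ (critExp d / 2)) := by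
    intro c hc
    have h1 := tendsto_lintegral_enorm_rpow_sub (p := critExp d) (by linarith) hc
      (fun n => Lp.aestronglyMeasurable (fnPart (v n))) (Lp.aestronglyMeasurable (fnPart u)) hae
      hufin
    have h2 : Tendsto (fun n => (c : ℝ≥0∞) * (sobolevConst 𝕜 d
        * ENNReal.ofReal (‖gradPart (v n - u)‖ ^ 2) ^ (critExp d / 2))) atTop
        (𝓝 (c * (sobolevConst 𝕜 d * ENNReal.ofReal r ^ (critExp d / 2)))) := by
      refine ENNReal.Tendsto.const_mul (ENNReal.Tendsto.const_mul ?_ (Or.inr hS.ne))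
        (Or.inr ENNReal.coe_ne_top)
      exact (ENNReal.continuous_rpow_const.tendsto _).comp
        ((ENNReal.continuous_ofReal.tendsto r).comp hr)
    refine le_of_tendsto_of_tendsto' hb (h1.add h2) fun n => ?_
    refine (hbv n).trans ((critIntegral_le_lintegral_sub_add (v n) u c).trans ?_)
    gcongr
    exact critIntegral_le_sobolevConst_mul_sq hd hΩ hlam (Submodule.sub_mem _ (hv n) hu)
  have h3 : Tendsto (fun c : ℝ≥0 => critIntegral u
      + (c : ℝ≥0∞) * (sobolevConst 𝕜 d * ENNReal.ofReal r ^ (critExp d / 2))) (𝓝[>] 1)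
      (𝓝 (critIntegral u
        + ((1 : ℝ≥0) : ℝ≥0∞) * (sobolevConst 𝕜 d * ENNReal.ofReal r ^ (critExp d / 2)))) := by
    refine Tendsto.mono_left ?_ nhdsWithin_le_nhds
    refine Tendsto.const_add _ (ENNReal.Tendsto.mul_const ?_ (Or.inr hX))
    exact ENNReal.continuous_coe.tendsto 1
  rw [ENNReal.coe_one, one_mul] at h3
  exact ge_of_tendsto h3 (eventually_nhdsWithin_of_forall fun c hc => key c hc)

end Maximiser

/-! ### Existence of a maximiser -/

open Filter Topology in
theorem mainTheorem11 (𝕜 : Type*) [RCLike 𝕜] (d : ℕ) (hd : 3 ≤ d)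
    (Ω : TopologicalSpace.Opens (EuclideanSpace ℝ (Fin d)))
    (hΩ : Bornology.IsBounded (Ω : Set (EuclideanSpace ℝ (Fin d))))
    (lam : ℝ) (hlam0 : 0 ≤ lam) (hlam1 : lam < lambda1 𝕜 Ω)
    (hS : sobolevConst 𝕜 d < brezisNirenbergConst 𝕜 Ω lam) :
    ∃ u ∈ H10 𝕜 Ω,
      ‖gradPart u‖ ^ 2 - lam * ‖fnPart u‖ ^ 2 = 1 ∧
      critIntegral u < ⊤ ∧
      critIntegral u = brezisNirenbergConst 𝕜 Ω lam := by
  have hlam : 0 < lambda1 𝕜 Ω := hlam0.trans_lt hlam1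
  have hStop : sobolevConst 𝕜 d < ⊤ := hS.trans_le le_top
  have hLtop : brezisNirenbergConst 𝕜 Ω lam < ⊤ :=
    brezisNirenbergConst_lt_top hd hΩ hlam0 hlam1 hStop
  obtain ⟨C, hC0, hC⟩ := exists_norm_sq_le_mul_form hΩ hlam0 hlam1
  -- The levels `b n` increase to `S_λ`; an admissible function above each level gives a maximising
  -- sequence.
  obtain ⟨b, -, hb1, hb2⟩ := exists_seq_strictMono_tendsto' hS
  have hex : ∀ n, ∃ u : H1 𝕜 Ω, (u ∈ H10 𝕜 Ω ∧
      ‖gradPart u‖ ^ 2 - lam * ‖fnPart u‖ ^ 2 = 1) ∧ b n < critIntegral u := by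
    intro n
    have h := (hb1 n).2
    simp only [brezisNirenbergConst, lt_iSup_iff] at h
    obtain ⟨u, hu, hbu⟩ := h
    exact ⟨u, hu, hbu⟩
  choose u hu hbu using hex
  have hbound : ∀ n, ‖u n‖ ≤ Real.sqrt C := by
    intro n
    refine Real.le_sqrt_of_sq_le ?_
    have h := hC (u n) (hu n).1
    rwa [(hu n).2, mul_one] at h
  obtain ⟨u₀, hu₀, φ, hφ, hL2, hae, hw⟩ :=
    exists_subseq_tendsto_of_bounded_H10 hΩ u (fun n => (hu n).1) _ hbound
  have hr := tendsto_norm_gradPart_sub_sq (fun n => (hu (φ n)).2) hL2 hw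
  have hle := le_critIntegral_add_of_tendsto hd hΩ hlam hStop (fun n => (hu (φ n)).1) hu₀
    (hb2.comp hφ.tendsto_atTop) (fun n => (hbu (φ n)).le) hae hr
  -- A limit of squares is nonnegative, so `1 - t ≥ 0` with `t` the form at the weak limit.
  have ht1 := ge_of_tendsto' hr (fun n => sq_nonneg _)
  have hcrit : critIntegral u₀ ≤ brezisNirenbergConst 𝕜 Ω lam
      * ENNReal.ofReal (‖gradPart u₀‖ ^ 2 - lam * ‖fnPart u₀‖ ^ 2) ^ (critExp d / 2) := by
    -- A vanishing weak limit is not yet excluded and cannot be normalised; the bound is then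
    -- trivial.
    by_cases h0 : u₀ = 0
    · rw [h0, critIntegral_eq_zero hd]
      exact zero_le
    · refine critIntegral_le_brezisNirenbergConst_mul hd hu₀ ?_
      have h1 : 0 < ‖u₀‖ ^ 2 := pow_pos (norm_pos_iff.2 h0) 2
      exact pos_of_mul_pos_right (h1.trans_le (hC u₀ hu₀)) hC0.le
  have ht0 : 0 ≤ ‖gradPart u₀‖ ^ 2 - lam * ‖fnPart u₀‖ ^ 2 :=
    nonneg_of_mul_nonneg_right ((sq_nonneg _).trans (hC u₀ hu₀)) hC0
  have ht : ‖gradPart u₀‖ ^ 2 - lam * ‖fnPart u₀‖ ^ 2 = 1 :=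
    eq_one_of_le_mul_rpow_add (p := critExp d / 2) hLtop.ne hS ht0 (sub_nonneg.1 ht1)
      (by linarith [two_lt_critExp hd]) (hle.trans (by gcongr))
  have hle2 : critIntegral u₀ ≤ brezisNirenbergConst 𝕜 Ω lam :=
    le_iSup₂ (f := fun (u : H1 𝕜 Ω)
      (_ : u ∈ {u : H1 𝕜 Ω | u ∈ H10 𝕜 Ω ∧ ‖gradPart u‖ ^ 2 - lam * ‖fnPart u‖ ^ 2 = 1}) =>
        critIntegral u) u₀ ⟨hu₀, ht⟩
  refine ⟨u₀, hu₀, ht, hle2.trans_lt hLtop, le_antisymm hle2 ?_⟩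
  have hq : 0 < critExp d / 2 := by linarith [two_lt_critExp hd]
  -- With `t = 1` the remainder carries the factor `0^(q/2) = 0`, and the splitting inequality is
  -- the missing lower bound.
  rw [ht, sub_self, ENNReal.ofReal_zero, ENNReal.zero_rpow_of_pos hq, mul_zero, add_zero] at hle
  exact hle
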